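/- Proposition (Unimodular Gauss–Bonnet theorem). Let $V$ be a $3$-dimensional real vector space with a (full-rank) lattice $N\subset V$. Let $\Delta$ be a complete unimodular fan in $V$, that is, a finite collection of convex cones with apex at the origin, closed under taking faces, such that any two cones of $\Delta$ intersect in a common face, the union of all cones is $V$, and every cone is generated by a part of a $\mathbb{Z}$-basis of $N$ (so that $\Delta$ is in particular simplicial). Let $K$ be the underlying simplicial complex of $\Delta$: its vertices are the primitive generators in $N$ of the rays of $\Delta$, and a set of vertices is a simplex if it generates a cone of $\Delta$. A wall is a simplex $J=\{j_1,j_2\}$ of $K$ with two vertices. Its unimodular curvature is $\operatorname{curv}(J)=2-a_1-a_2$, where $J\cup\{i\}$ and $J\cup\{i'\}$ are two different maximal simplices of $K$ containing $J$ and the integers $a_1,a_2$ are determined by $i'=a_1j_1+a_2j_2-i$. Then $\operatorname{curv}(J)$ is well defined for every wall $J$ (such $i,i',a_1,a_2$ exist and the value does not depend on the choice), and $$\sum_{J\in K,\ |J|=2}\operatorname{curv}(J)=24 .$$ -/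

import Mathlib

/-- A fan in a real vector space `V`: a finite collection of convex cones with apex at the origin,
closed under passing to faces, in which any two cones intersect in a common face (the intersection
then also lies in the collection). -/
structure ConeFan (V : Type*) [AddCommGroup V] [Module ℝ V] where
  cones : Finset (PointedCone ℝ V)
  face_mem : ∀ σ ∈ cones, ∀ τ : PointedCone ℝ V, τ.IsFaceOf σ → τ ∈ cones
  inf_isFaceOf : ∀ σ ∈ cones, ∀ τ ∈ cones, (σ ⊓ τ).IsFaceOf σ ∧ (σ ⊓ τ).IsFaceOf τ

/-- A cone is unimodular with respect to the lattice `N` if it is generated by a part of a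
`ℤ`-basis of `N`. -/
def IsUnimodularCone {V : Type*} [AddCommGroup V] [Module ℝ V] (N : Submodule ℤ V)
    (σ : PointedCone ℝ V) : Prop :=
  ∃ (b : Module.Basis (Fin (Module.finrank ℤ N)) ℤ N) (s : Set (Fin (Module.finrank ℤ N))),
    σ = PointedCone.hull ℝ ((fun k => (b k : V)) '' s)

/-- A primitive vector of the lattice `N`: a nonzero lattice vector which is not a proper integer
multiple of a lattice vector. -/
def IsPrimitiveVector {V : Type*} [AddCommGroup V] (N : Submodule ℤ V) (v : V) : Prop :=
  v ∈ N ∧ v ≠ 0 ∧ ∀ (k : ℤ), ∀ w ∈ N, v = k • w → IsUnit k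

/-- A primitive lattice vector is determined by the ray that it spans. -/
theorem IsPrimitiveVector.eq_of_hull_eq {V : Type*} [NormedAddCommGroup V] [NormedSpace ℝ V]
    {N : Submodule ℤ V} [DiscreteTopology N] {v w : V}
    (hv : IsPrimitiveVector N v) (hw : IsPrimitiveVector N w)
    (h : PointedCone.hull ℝ {v} = PointedCone.hull ℝ {w}) : v = w := by
  obtain ⟨hvN, hv0, hvp⟩ := hv
  obtain ⟨hwN, hw0, hwp⟩ := hw
  have hmem : v ∈ PointedCone.hull ℝ {w} := h ▸ Submodule.subset_span rfl
  obtain ⟨⟨r, hr⟩, hrv⟩ := Submodule.mem_span_singleton.1 hmem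
  replace hrv : r • w = v := hrv
  have hG : ∃ g : ℝ, ∀ t : ℝ, t • w ∈ N ↔ ∃ m : ℤ, t = m * g := by
    let G : AddSubgroup ℝ := N.toAddSubgroup.comap (LinearMap.toSpanSingleton ℝ V w).toAddMonoidHom
    have hGd : DiscreteTopology G := by
      have hinj : Function.Injective (fun t : ℝ => t • w) := smul_left_injective ℝ hw0
      have hc : Continuous (fun t : G => (⟨(t : ℝ) • w, t.2⟩ : N)) := by fun_prop
      exact DiscreteTopology.of_continuous_injective hc
        (fun a b hab => Subtype.ext (hinj (congrArg Subtype.val hab)))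
    obtain ⟨g, hg⟩ := (AddSubgroup.discrete_iff_addCyclic.2 hGd).exists_zsmul_surjective
    refine ⟨g, fun t => ?_⟩
    constructor
    · intro ht
      obtain ⟨m, hm⟩ := hg ⟨t, ht⟩
      refine ⟨m, ?_⟩
      have := congrArg Subtype.val hm
      simpa using this.symm
    · rintro ⟨m, rfl⟩
      have : (m • g : G).1 ∈ G := (m • g : G).2
      simpa [G] using this
  obtain ⟨g, hg⟩ := hG
  obtain ⟨k, hk⟩ := (hg 1).1 (by simpa using hwN)
  have hgN : g • w ∈ N := (hg g).2 ⟨1, by simp⟩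
  have hku := hwp k (g • w) hgN (by rw [← Int.cast_smul_eq_zsmul ℝ, smul_smul, ← hk, one_smul])
  obtain ⟨m, hm⟩ := (hg r).1 (by rw [hrv]; exact hvN)
  have hmu := hvp m (g • w) hgN (by rw [← Int.cast_smul_eq_zsmul ℝ, smul_smul, ← hm, hrv])
  have hr1 : r = 1 := by
    rcases Int.isUnit_iff.1 hku with rfl | rfl <;> rcases Int.isUnit_iff.1 hmu with rfl | rfl <;>
      push_cast at hk hm <;> linarith
  rw [← hrv, hr1, one_smul]

namespace ConeFan

section Basic

variable {V : Type*} [AddCommGroup V] [Module ℝ V]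

/-- A fan is complete if its cones cover the whole space. -/
def IsComplete (Δ : ConeFan V) : Prop :=
  ∀ x : V, ∃ σ ∈ Δ.cones, x ∈ σ

/-- A fan is unimodular if all its cones are (in particular it is then simplicial). -/
def IsUnimodular (Δ : ConeFan V) (N : Submodule ℤ V) : Prop :=
  ∀ σ ∈ Δ.cones, IsUnimodularCone N σ

end Basic

variable {V : Type*} [NormedAddCommGroup V] [NormedSpace ℝ V]

theorem finite_primitive (Δ : ConeFan V) (N : Submodule ℤ V) [DiscreteTopology N] :
    {v : V | IsPrimitiveVector N v ∧ PointedCone.hull ℝ {v} ∈ Δ.cones}.Finite :=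
  Set.Finite.of_finite_image (f := fun v => PointedCone.hull ℝ {v})
    (Δ.cones.finite_toSet.subset (by rintro _ ⟨v, hv, rfl⟩; exact hv.2))
    (fun _ hv _ hw h => hv.1.eq_of_hull_eq hw.1 h)

/-- The primitive generators of the rays of the fan; they serve as the vertices of the underlying
simplicial complex `K`. -/
noncomputable def rayGenerators (Δ : ConeFan V) (N : Submodule ℤ V) [DiscreteTopology N] :
    Finset V :=
  (Δ.finite_primitive N).toFinset

open Classical in
/-- The simplices with `k` vertices of the underlying simplicial complex `K` of the fan: sets of
`k` ray generators that span a cone of the fan. -/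
noncomputable def simplices (Δ : ConeFan V) (N : Submodule ℤ V) [DiscreteTopology N] (k : ℕ) :
    Finset (Finset V) :=
  {I ∈ (Δ.rayGenerators N).powersetCard k | PointedCone.hull ℝ (I : Set V) ∈ Δ.cones}

/-- The walls of a fan in an `n`-dimensional space: the simplices of `K` with `n - 1` vertices. -/
noncomputable def walls (Δ : ConeFan V) (N : Submodule ℤ V) [DiscreteTopology N] :
    Finset (Finset V) :=
  Δ.simplices N (Module.finrank ℝ V - 1)

open Classical in
/-- `c = 2 - ∑ aⱼ`, where `J ∪ {i}` and `J ∪ {i'}` are two different maximal simplices containing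
the wall `J`, and `i' = ∑ aⱼ j - i` with integers `aⱼ`, `j ∈ J`. -/
def HasCurvature (Δ : ConeFan V) (N : Submodule ℤ V) [DiscreteTopology N] (J : Finset V)
    (c : ℤ) : Prop :=
  ∃ (i i' : V) (a : V → ℤ), i ≠ i' ∧
    insert i J ∈ Δ.simplices N (Module.finrank ℝ V) ∧
    insert i' J ∈ Δ.simplices N (Module.finrank ℝ V) ∧
    i' = (∑ j ∈ J, a j • j) - i ∧
    c = 2 - ∑ j ∈ J, a j

/-- The unimodular curvature of a wall. -/
noncomputable def curv (Δ : ConeFan V) (N : Submodule ℤ V) [DiscreteTopology N] (J : Finset V) :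
    ℤ :=
  Classical.epsilon (Δ.HasCurvature N J)

end ConeFan

/-!
The identity is the degree-two part of the Todd genus of the toric variety of `Δ`, obtained here by
a lattice sum. Fix a generic `x` and let `c_v` be its coordinates in a chamber `I`. A wall relation
changes the coordinates by a multiple of the coordinate across the wall, so the total curvature is
`∑_I (∑_v c_v) (∑_v c_v⁻¹)`, summed over the chambers `I`.

For a functional `μ` of the dual lattice, the signed number of chambers in which the signs of `c_v`
and `μ v` match does not change when `x` crosses a wall. Hence it is `0` for `μ ≠ 0`, as one sees by
moving `x` to a point where `μ` is negative, and it is `1` for `μ = 0`. Summing these numbers with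
weights `exp (-μ x)` over the dual lattice turns each chamber into a product of geometric series, so
`∑_I ∏_v 1 / (1 - exp (-c_v)) = 1`. Replacing `x` by `t • x` gives
`∑_I ∏_v c_v⁻¹ * todd (t * c_v) = t ^ n`. For `n = 3` the product of the Todd functions has the
coefficient `(∏_v c_v) (∑_v c_v) (∑_v c_v⁻¹) / 24` at `t ^ 3`, and comparing these coefficients
gives the total `24`.
-/

open Asymptotics Filter PointedCone Topology

section Coordinates

variable {K V : Type*} [Field K] [AddCommGroup V] [Module K V] {I J : Finset V} {v w x : V}

open Classical in
/-- The coordinate functional at `v` with respect to a linearly independent set `I`. It is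
determined only on the span of `I`, so some extension to the whole space is chosen. -/
noncomputable def coord (K : Type*) {V : Type*} [Field K] [AddCommGroup V] [Module K V]
    (I : Finset V) (v : V) : V →ₗ[K] K :=
  Classical.epsilon fun f => ∀ w ∈ I, f w = if w = v then 1 else 0

open Classical in
theorem coord_apply_of_mem (hI : LinearIndepOn K id (I : Set V)) (hw : w ∈ I) :
    coord K I v w = if w = v then 1 else 0 := by
  have hexists : ∃ f : V →ₗ[K] K, ∀ w ∈ I, f w = if w = v then 1 else 0 := by
    let b := Module.Basis.extend hI
    refine ⟨b.constr K fun k => if (k : V) = v then 1 else 0, fun w hw => ?_⟩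
    have hbw : b ⟨w, hI.subset_extend _ hw⟩ = w := Module.Basis.extend_apply_self hI _
    conv_lhs => rw [← hbw, b.constr_basis]
  exact Classical.epsilon_spec hexists w hw

theorem coord_self (hI : LinearIndepOn K id (I : Set V)) (hv : v ∈ I) : coord K I v v = 1 := by
  rw [coord_apply_of_mem hI hv, if_pos rfl]

theorem coord_of_ne (hI : LinearIndepOn K id (I : Set V)) (hw : w ∈ I) (hwv : w ≠ v) :
    coord K I v w = 0 := by
  rw [coord_apply_of_mem hI hw, if_neg hwv]

theorem coord_sum_smul_of_subset (hI : LinearIndepOn K id (I : Set V)) (hJ : J ⊆ I) (c : V → K)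
    (hv : v ∈ J) : coord K I v (∑ w ∈ J, c w • w) = c v := by
  rw [map_sum, Finset.sum_eq_single_of_mem v hv]
  · rw [map_smul, coord_self hI (hJ hv), smul_eq_mul, mul_one]
  · intro w hw hwv
    rw [map_smul, coord_of_ne hI (hJ hw) hwv, smul_zero]

theorem sum_coord_smul (hI : LinearIndepOn K id (I : Set V))
    (hx : x ∈ Submodule.span K (I : Set V)) : ∑ v ∈ I, coord K I v x • v = x := by
  obtain ⟨c, -, rfl⟩ := Submodule.mem_span_finset.1 hx
  exact Finset.sum_congr rfl fun v hv => by rw [coord_sum_smul_of_subset hI subset_rfl c hv]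

theorem apply_eq_sum_coord_mul (hI : LinearIndepOn K id (I : Set V))
    (hx : x ∈ Submodule.span K (I : Set V)) (f : V →ₗ[K] K) :
    f x = ∑ v ∈ I, coord K I v x * f v := by
  conv_lhs => rw [← sum_coord_smul hI hx]
  simp only [map_sum, map_smul, smul_eq_mul]

theorem coord_eq_of_forall_apply_eq (hI : LinearIndepOn K id (I : Set V))
    (hspan : Submodule.span K (I : Set V) = ⊤) {f : V →ₗ[K] K} (hv : f v = 1)
    (hne : ∀ w ∈ I, w ≠ v → f w = 0) : coord K I v = f := by
  refine LinearMap.ext_on hspan fun w hw => ?_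
  rcases eq_or_ne w v with rfl | hwv
  · rw [coord_self hI hw, hv]
  · rw [coord_of_ne hI hw hwv, hne w hw hwv]

variable [DecidableEq V] {i i' j : V}

theorem apply_eq_coord_insert_mul (hI : LinearIndepOn K id (↑(insert i J) : Set V))
    (hx : x ∈ Submodule.span K (↑(insert i J) : Set V)) {f : V →ₗ[K] K} (hf : ∀ w ∈ J, f w = 0) :
    f x = coord K (insert i J) i x * f i := by
  rw [apply_eq_sum_coord_mul hI hx f, Finset.sum_eq_single_of_mem i (Finset.mem_insert_self i J)]
  exact fun w hw hwi => by rw [hf w (Finset.mem_of_mem_insert_of_ne hw hwi), mul_zero]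

theorem coord_insert_self_of_mem (hI : LinearIndepOn K id (↑(insert i J) : Set V)) (hiJ : i ∉ J)
    (hw : w ∈ J) : coord K (insert i J) i w = 0 :=
  coord_of_ne hI (Finset.mem_insert_of_mem hw) (ne_of_mem_of_not_mem hw hiJ)

theorem coord_insert_self_exchange (hI : LinearIndepOn K id (↑(insert i J) : Set V))
    (hI' : LinearIndepOn K id (↑(insert i' J) : Set V))
    (hspan' : Submodule.span K (↑(insert i' J) : Set V) = ⊤) (hiJ : i ∉ J)
    (hii' : coord K (insert i J) i i' ≠ 0) :
    coord K (insert i' J) i' = (coord K (insert i J) i i')⁻¹ • coord K (insert i J) i := by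
  refine coord_eq_of_forall_apply_eq hI' hspan' (inv_mul_cancel₀ hii') fun w hw hwi' => ?_
  rw [LinearMap.smul_apply,
    coord_insert_self_of_mem hI hiJ (Finset.mem_of_mem_insert_of_ne hw hwi'), smul_zero]

theorem coord_insert_of_mem_exchange (hI : LinearIndepOn K id (↑(insert i J) : Set V))
    (hI' : LinearIndepOn K id (↑(insert i' J) : Set V))
    (hspan' : Submodule.span K (↑(insert i' J) : Set V) = ⊤) (hiJ : i ∉ J)
    (hii' : coord K (insert i J) i i' ≠ 0) (hj : j ∈ J) :
    coord K (insert i' J) j = coord K (insert i J) j -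
      (coord K (insert i J) j i' / coord K (insert i J) i i') • coord K (insert i J) i := by
  have hvanish : ∀ w ∈ J, coord K (insert i J) i w = 0 := fun w hw =>
    coord_insert_self_of_mem hI hiJ hw
  refine coord_eq_of_forall_apply_eq hI' hspan' ?_ fun w hw hwj => ?_
  · simp [coord_self hI (Finset.mem_insert_of_mem hj), hvanish j hj]
  · rcases Finset.mem_insert.1 hw with rfl | hwJ
    · simp [hii']
    · simp [coord_of_ne hI (Finset.mem_insert_of_mem hwJ) hwj, hvanish w hwJ]

end Coordinates

section Hull

section OrderedField

variable {K V : Type*} [Field K] [LinearOrder K] [IsStrictOrderedRing K] [AddCommGroup V]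
  [Module K V] {I A : Finset V} {x : V}

theorem sum_smul_mem_hull {c : V → K} (hc : ∀ v ∈ I, 0 ≤ c v) :
    ∑ v ∈ I, c v • v ∈ hull K (I : Set V) :=
  Submodule.sum_mem _ fun v hv => (hull K (I : Set V)).smul_mem (hc v hv) (subset_hull hv)

theorem mem_hull_finset : x ∈ hull K (I : Set V) ↔
    ∃ c : V → K, (∀ v, 0 ≤ c v) ∧ ∑ v ∈ I, c v • v = x := by
  refine ⟨fun hx => ?_, ?_⟩
  · obtain ⟨c, hcI, hc, rfl⟩ := mem_hull_set.1 hx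
    exact ⟨c, hc, (Finsupp.sum_of_support_subset c (by exact_mod_cast hcI) (fun v a => a • v)
      fun v _ => zero_smul K v).symm⟩
  · rintro ⟨c, hc, rfl⟩
    exact sum_smul_mem_hull fun v _ => hc v

theorem mem_hull_of_subset_iff (hI : LinearIndepOn K id (I : Set V)) (hA : A ⊆ I) :
    x ∈ hull K (A : Set V) ↔ x ∈ Submodule.span K (I : Set V) ∧
      (∀ v ∈ I, 0 ≤ coord K I v x) ∧ ∀ v ∈ I, v ∉ A → coord K I v x = 0 := by
  have hsum : ∀ c : V → K, (∀ v ∈ I, v ∉ A → c v = 0) → ∑ v ∈ A, c v • v = ∑ v ∈ I, c v • v :=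
    fun c hc => Finset.sum_subset hA fun v hv hvA => by rw [hc v hv hvA, zero_smul]
  constructor
  · intro hx
    classical
    obtain ⟨c, hc, rfl⟩ := mem_hull_finset.1 hx
    have hcoord : ∀ v ∈ I, coord K I v (∑ w ∈ A, c w • w) = if v ∈ A then c v else 0 := by
      intro v hv
      rw [← coord_sum_smul_of_subset hI subset_rfl (fun w => if w ∈ A then c w else 0) hv,
        ← hsum _ fun w _ hwA => if_neg hwA]
      exact congrArg _ (Finset.sum_congr rfl fun w hw => by rw [if_pos hw])
    refine ⟨hull_le_span K _ (Submodule.span_mono (by exact_mod_cast hA) hx), fun v hv => ?_,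
      fun v hv hvA => by rw [hcoord v hv, if_neg hvA]⟩
    rw [hcoord v hv]
    split_ifs
    exacts [hc v, le_rfl]
  · rintro ⟨hxI, hnonneg, hzero⟩
    rw [← sum_coord_smul hI hxI, ← hsum _ hzero]
    exact sum_smul_mem_hull fun v hv => hnonneg v (hA hv)

theorem mem_hull_iff_coord_nonneg (hI : LinearIndepOn K id (I : Set V)) :
    x ∈ hull K (I : Set V) ↔ x ∈ Submodule.span K (I : Set V) ∧ ∀ v ∈ I, 0 ≤ coord K I v x := by
  rw [mem_hull_of_subset_iff hI subset_rfl]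
  exact and_congr_right fun _ => and_iff_left fun v hv hvI => absurd hv hvI

theorem isFaceOf_hull_of_subset (hI : LinearIndepOn K id (I : Set V)) (hA : A ⊆ I) :
    (hull K (A : Set V)).IsFaceOf (hull K (I : Set V)) := by
  refine ⟨Submodule.span_mono (by exact_mod_cast hA), fun {x y a} hx hy ha hxy => ?_⟩
  obtain ⟨hxI, hx0⟩ := (mem_hull_iff_coord_nonneg hI).1 hx
  obtain ⟨-, hy0⟩ := (mem_hull_iff_coord_nonneg hI).1 hy
  obtain ⟨-, -, hzero⟩ := (mem_hull_of_subset_iff hI hA).1 hxy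
  refine (mem_hull_of_subset_iff hI hA).2 ⟨hxI, hx0, fun v hv hvA => ?_⟩
  have hsum : a * coord K I v x + coord K I v y = 0 := by simpa using hzero v hv hvA
  have hax : a * coord K I v x = 0 :=
    ((add_eq_zero_iff_of_nonneg (mul_nonneg ha.le (hx0 v hv)) (hy0 v hv)).1 hsum).1
  exact (mul_eq_zero.1 hax).resolve_left ha.ne'

theorem mem_of_isFaceOf_hull_of_sum_smul_mem {F : PointedCone K V}
    (hF : F.IsFaceOf (hull K (I : Set V))) {c : V → K} (hc : ∀ v ∈ I, 0 ≤ c v)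
    (hs : ∑ v ∈ I, c v • v ∈ F) {v : V} (hv : v ∈ I) (hcv : 0 < c v) : v ∈ F := by
  rw [← Finset.sum_coe_sort I fun v => c v • v] at hs
  exact hF.mem_of_sum_smul_mem (fun w : I => subset_hull w.2) (fun w => hc w w.2) hs ⟨v, hv⟩ hcv

theorem hull_singleton_smul {a : K} (ha : 0 < a) (v : V) : hull K {a • v} = hull K {v} :=
  Submodule.span_singleton_smul_eq (r := (⟨a, ha.le⟩ : {c : K // 0 ≤ c}))
    (isUnit_iff_ne_zero.2 fun h => ha.ne' (congrArg Subtype.val h)) v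

end OrderedField

theorem isClosed_hull_of_linearIndepOn {V : Type*} [AddCommGroup V] [Module ℝ V]
    [TopologicalSpace V] [IsTopologicalAddGroup V] [ContinuousSMul ℝ V] [T2Space V]
    [FiniteDimensional ℝ V] {I : Finset V} (hI : LinearIndepOn ℝ id (I : Set V)) :
    IsClosed (hull ℝ (I : Set V) : Set V) := by
  have hset : (hull ℝ (I : Set V) : Set V) =
      (Submodule.span ℝ (I : Set V) : Set V) ∩ ⋂ v ∈ I, {x | 0 ≤ coord ℝ I v x} := by
    ext x
    simp [mem_hull_iff_coord_nonneg hI]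
  rw [hset]
  exact (Submodule.closed_of_finiteDimensional _).inter <| isClosed_biInter fun v _ =>
    isClosed_le continuous_const (LinearMap.continuous_of_finiteDimensional _)

end Hull

section LatticeBasis

variable {V : Type*} [AddCommGroup V] [Module ℝ V] {N : Submodule ℤ V} {I J : Finset V} {v x : V}

/-- `I` is a `ℤ`-basis of the lattice `N`. Linear independence is required over `ℝ`, as always holds
for a basis of a discrete subgroup. -/
structure IsLatticeBasis (N : Submodule ℤ V) (I : Finset V) : Prop where
  linearIndepOn : LinearIndepOn ℝ id (I : Set V)
  span_eq : Submodule.span ℤ (I : Set V) = N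

/-- The dual lattice: the linear functionals that take integer values on `N`. -/
def dualLattice (N : Submodule ℤ V) : Set (V →ₗ[ℝ] ℝ) :=
  {μ | ∀ x ∈ N, ∃ k : ℤ, (k : ℝ) = μ x}

theorem mem_dualLattice_of_forall_mem (hN : Submodule.span ℤ (I : Set V) = N) {μ : V →ₗ[ℝ] ℝ}
    (hμ : ∀ v ∈ I, ∃ k : ℤ, (k : ℝ) = μ v) : μ ∈ dualLattice N := by
  intro x hx
  rw [← hN] at hx
  induction hx using Submodule.span_induction with
  | mem v hv => exact hμ v hv
  | zero => exact ⟨0, by simp⟩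
  | add x y _ _ hx hy =>
    obtain ⟨k, hk⟩ := hx
    obtain ⟨l, hl⟩ := hy
    exact ⟨k + l, by rw [Int.cast_add, hk, hl, map_add]⟩
  | smul m x _ hx =>
    obtain ⟨k, hk⟩ := hx
    exact ⟨m * k, by rw [Int.cast_mul, hk, ← Int.cast_smul_eq_zsmul ℝ, map_smul, smul_eq_mul]⟩

namespace IsLatticeBasis

theorem mem_lattice (hI : IsLatticeBasis N I) (hv : v ∈ I) : v ∈ N :=
  hI.span_eq ▸ Submodule.subset_span hv

theorem coord_mem_dualLattice (hI : IsLatticeBasis N I) (v : V) : coord ℝ I v ∈ dualLattice N := by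
  classical
  refine mem_dualLattice_of_forall_mem hI.span_eq fun w hw => ⟨if w = v then 1 else 0, ?_⟩
  rw [coord_apply_of_mem hI.linearIndepOn hw]
  split_ifs <;> simp

theorem isPrimitiveVector (hI : IsLatticeBasis N I) (hv : v ∈ I) : IsPrimitiveVector N v := by
  have hv1 := coord_self hI.linearIndepOn hv
  refine ⟨hI.mem_lattice hv, ?_, fun k w hw hkw => ?_⟩
  · rintro rfl
    simp at hv1
  · obtain ⟨m, hm⟩ := hI.coord_mem_dualLattice v w hw
    have hkm := congrArg (coord ℝ I v) hkw
    rw [hv1, ← Int.cast_smul_eq_zsmul ℝ, map_smul, smul_eq_mul, ← hm] at hkm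
    exact .of_mul_eq_one m (by exact_mod_cast hkm.symm)

theorem exists_sum_int_smul_eq (hI : IsLatticeBasis N I) (hx : x ∈ N) :
    ∃ a : V → ℤ, ∑ v ∈ I, a v • v = x ∧ ∀ v ∈ I, (a v : ℝ) = coord ℝ I v x := by
  obtain ⟨a, -, rfl⟩ := Submodule.mem_span_finset.1 (hI.span_eq ▸ hx : x ∈ Submodule.span ℤ _)
  refine ⟨a, rfl, fun v hv => ?_⟩
  simp only [← Int.cast_smul_eq_zsmul ℝ]
  rw [coord_sum_smul_of_subset hI.linearIndepOn subset_rfl (fun w => (a w : ℝ)) hv]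

theorem coord_eq_one_or_neg_one [DecidableEq V] {i i' : V} (hI : IsLatticeBasis N (insert i J))
    (hI' : IsLatticeBasis N (insert i' J)) (hiJ : i ∉ J) :
    coord ℝ (insert i J) i i' = 1 ∨ coord ℝ (insert i J) i i' = -1 := by
  have hi := Finset.mem_insert_self i J
  obtain ⟨m, hm⟩ := hI.coord_mem_dualLattice i i' (hI'.mem_lattice (Finset.mem_insert_self i' J))
  obtain ⟨k, hk⟩ := hI'.coord_mem_dualLattice i' i (hI.mem_lattice hi)
  have hmul : (k : ℝ) * m = 1 := by
    have hspan : i ∈ Submodule.span ℝ (↑(insert i' J) : Set V) :=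
      Submodule.span_subset_span ℤ ℝ _ (hI'.span_eq ▸ hI.mem_lattice hi)
    have hmul := apply_eq_coord_insert_mul hI'.linearIndepOn hspan fun w hw =>
      coord_insert_self_of_mem hI.linearIndepOn hiJ hw
    rwa [coord_self hI.linearIndepOn hi, ← hm, ← hk, eq_comm] at hmul
  rw [← hm]
  rcases Int.isUnit_iff.1 (IsUnit.of_mul_eq_one_right k (by exact_mod_cast hmul)) with h | h
  · exact .inl (by exact_mod_cast h)
  · exact .inr (by exact_mod_cast h)

/-- The dual basis identifies the dual lattice with integer vectors indexed by the basis. -/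
noncomputable def dualLatticeEquiv (hI : IsLatticeBasis N I)
    (hspan : Submodule.span ℝ (I : Set V) = ⊤) : dualLattice N ≃ (I → ℤ) :=
  Equiv.ofBijective (fun μ v => (μ.2 v (hI.mem_lattice v.2)).choose) <| by
    have hchoose (μ : dualLattice N) (v : I) :
      ((μ.2 v (hI.mem_lattice v.2)).choose : ℝ) = μ.1 v :=
      (μ.2 v (hI.mem_lattice v.2)).choose_spec
    constructor
    · intro μ ν hμν
      refine Subtype.ext (LinearMap.ext_on hspan fun v hv => ?_)
      rw [← hchoose μ ⟨v, hv⟩, ← hchoose ν ⟨v, hv⟩]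
      exact congrArg _ (congrFun hμν ⟨v, hv⟩)
    · intro z
      have hz (w : I) : (∑ v : I, (z v : ℝ) • coord ℝ I (v : V)) w = z w := by
        rw [LinearMap.sum_apply, Fintype.sum_eq_single w]
        · simp [coord_self hI.linearIndepOn w.2]
        · intro v hvw
          simp [coord_of_ne hI.linearIndepOn w.2 (Subtype.coe_ne_coe.2 hvw.symm)]
      have hmem : ∑ v : I, (z v : ℝ) • coord ℝ I (v : V) ∈ dualLattice N :=
        mem_dualLattice_of_forall_mem hI.span_eq fun w hw => ⟨z ⟨w, hw⟩, (hz ⟨w, hw⟩).symm⟩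
      exact ⟨⟨_, hmem⟩, funext fun w => Int.cast_injective ((hchoose ⟨_, hmem⟩ w).trans (hz w))⟩

theorem dualLatticeEquiv_apply (hI : IsLatticeBasis N I)
    (hspan : Submodule.span ℝ (I : Set V) = ⊤) (μ : dualLattice N) (v : I) :
    (hI.dualLatticeEquiv hspan μ v : ℝ) = μ.1 v :=
  (μ.2 v (hI.mem_lattice v.2)).choose_spec

end IsLatticeBasis

section Normed

variable {V : Type*} [NormedAddCommGroup V] [NormedSpace ℝ V] {N : Submodule ℤ V} {B : Finset V}
  [DiscreteTopology N] [IsZLattice ℝ N]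

theorem IsLatticeBasis.span_real_eq_top (hB : IsLatticeBasis N B) :
    Submodule.span ℝ (B : Set V) = ⊤ := by
  rw [← Submodule.span_span_of_tower ℤ ℝ, hB.span_eq, IsZLattice.span_top]

theorem IsLatticeBasis.card_eq_finrank (hB : IsLatticeBasis N B) :
    B.card = Module.finrank ℝ V := by
  rw [← finrank_span_finset_eq_card hB.linearIndepOn, hB.span_real_eq_top, finrank_top]

theorem exists_isLatticeBasis_of_isUnimodularCone [FiniteDimensional ℝ V] {σ : PointedCone ℝ V}
    (hσ : IsUnimodularCone N σ) :
    ∃ B : Finset V, IsLatticeBasis N B ∧ ∃ I ⊆ B, σ = hull ℝ (I : Set V) := by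
  classical
  obtain ⟨b, s, rfl⟩ := hσ
  have hB : (↑(Finset.univ.image fun k => (b k : V)) : Set V) = Set.range (N.subtype ∘ b) := by
    rw [Finset.coe_image, Finset.coe_univ, Set.image_univ]; rfl
  refine ⟨Finset.univ.image fun k => (b k : V), ⟨?_, ?_⟩,
    (Finset.univ.filter (· ∈ s)).image fun k => (b k : V),
    Finset.image_subset_image (Finset.filter_subset _ _), by simp⟩
  · have hb : N.subtype ∘ b = b.ofZLatticeBasis ℝ N := funext fun k => by simp
    rw [hB, hb]
    exact (b.ofZLatticeBasis ℝ N).linearIndependent.linearIndepOn_id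
  · rw [hB, Set.range_comp, Submodule.span_image, b.span_eq, Submodule.map_subtype_top]

end Normed

end LatticeBasis

section PosStep

/-- The indicator function of the positive reals. -/
noncomputable def posStep (x : ℝ) : ℝ := if 0 < x then 1 else 0

theorem posStep_of_pos {x : ℝ} (hx : 0 < x) : posStep x = 1 := if_pos hx

theorem posStep_of_nonpos {x : ℝ} (hx : x ≤ 0) : posStep x = 0 := if_neg hx.not_gt

theorem posStep_mul_of_pos {t : ℝ} (ht : 0 < t) (x : ℝ) : posStep (t * x) = posStep x := by
  simp only [posStep, mul_pos_iff_of_pos_left ht]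

theorem posStep_neg {x : ℝ} (hx : x ≠ 0) : posStep (-x) = 1 - posStep x := by
  rcases hx.lt_or_gt with hneg | hpos
  · rw [posStep_of_pos (neg_pos.2 hneg), posStep_of_nonpos hneg.le, sub_zero]
  · rw [posStep_of_nonpos (neg_nonpos.2 hpos.le), posStep_of_pos hpos, sub_self]

theorem neg_div_pos_of_posStep_ne {x y : ℝ} (hx : x ≠ 0) (hy : y ≠ 0)
    (hxy : posStep x ≠ posStep y) : 0 < -x / y := by
  rcases hx.lt_or_gt with hx | hx <;> rcases hy.lt_or_gt with hy | hy
  · exact absurd ((posStep_of_nonpos hx.le).trans (posStep_of_nonpos hy.le).symm) hxy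
  · exact div_pos (neg_pos.2 hx) hy
  · exact div_pos_of_neg_of_neg (neg_neg_of_pos hx) hy
  · exact absurd ((posStep_of_pos hx).trans (posStep_of_pos hy).symm) hxy

/-- On the segment from `(x, x')` to `(y, y')`, the value of the second coordinate at the zero of
the first one is a positive multiple of `x' - x / y * y'`; its sign is that of `x'` or that of `y'`
according to which of the two coordinates vanishes first. -/
theorem posStep_sub_div_mul {x y x' y' : ℝ} (hx : x ≠ 0) (hy : y ≠ 0) (hy' : y' ≠ 0)
    (hxy : posStep x ≠ posStep y) (hne : -x / y ≠ -x' / y') :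
    posStep (x' - x / y * y') = if -x / y < -x' / y' then posStep x' else posStep y' := by
  have hs := neg_div_pos_of_posStep_ne hx hy hxy
  generalize hsx : -x / y = s at *
  generalize hsx' : -x' / y' = s' at *
  have hx' : x' = -(s' * y') := by rw [← hsx', div_mul_cancel₀ _ hy', neg_neg]
  have hcross : x' - x / y * y' = (s - s') * y' := by rw [hx', ← hsx]; ring
  rw [hcross]
  split_ifs with hlt
  · have hneg : x' = s' * -y' := by rw [hx']; ring
    have hcross' : (s - s') * y' = (s' - s) * -y' := by ring
    rw [hcross', hneg, posStep_mul_of_pos (sub_pos.2 hlt), posStep_mul_of_pos (hs.trans hlt)]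
  · exact posStep_mul_of_pos (sub_pos.2 (lt_of_le_of_ne (not_lt.1 hlt) hne.symm)) y'

theorem prod_sub_prod_eq_sum_of_injOn {ι S R : Type*} [DecidableEq ι] [LinearOrder S] [CommRing R]
    {I : Finset ι} {s : ι → S} (hs : Set.InjOn s I) (x y : ι → R) :
    ∏ v ∈ I, x v - ∏ v ∈ I, y v =
      ∑ v ∈ I, (x v - y v) * ∏ u ∈ I.erase v, if s v < s u then x u else y u := by
  induction I using Finset.induction_on_max_value s with
  | empty => simp
  | insert a I ha hmax ih =>
    have hlt : ∀ v ∈ I, s v < s a := fun v hv => lt_of_le_of_ne (hmax v hv) fun h =>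
      ha (hs (Finset.mem_insert_of_mem hv) (Finset.mem_insert_self a I) h ▸ hv)
    have herase : ∀ v ∈ I, (insert a I).erase v = insert a (I.erase v) := fun v hv =>
      Finset.erase_insert_of_ne (ne_of_mem_of_not_mem hv ha).symm
    have hlast : ∏ u ∈ I, (if s a < s u then x u else y u) = ∏ u ∈ I, y u :=
      Finset.prod_congr rfl fun u hu => if_neg (hlt u hu).not_gt
    rw [Finset.prod_insert ha, Finset.prod_insert ha, Finset.sum_insert ha, Finset.erase_insert ha,
      hlast]
    calc x a * ∏ v ∈ I, x v - y a * ∏ v ∈ I, y v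
        = (x a - y a) * ∏ v ∈ I, y v + x a * (∏ v ∈ I, x v - ∏ v ∈ I, y v) := by ring
      _ = _ := ?_
    rw [ih (hs.mono (Finset.coe_subset.2 (Finset.subset_insert a I))), Finset.mul_sum]
    congr 1
    refine Finset.sum_congr rfl fun v hv => ?_
    rw [herase v hv, Finset.prod_insert fun h => ha (Finset.mem_of_mem_erase h), if_pos (hlt v hv)]
    ring

theorem prod_posStep_sub_prod_posStep {ι : Type*} [DecidableEq ι] {I : Finset ι} {x y : ι → ℝ}
    (hx : ∀ v ∈ I, x v ≠ 0) (hy : ∀ v ∈ I, y v ≠ 0)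
    (hxy : ∀ v ∈ I, ∀ u ∈ I, v ≠ u → x v * y u ≠ x u * y v) (b : ι → ℝ) :
    ∏ v ∈ I, (posStep (x v) - b v) - ∏ v ∈ I, (posStep (y v) - b v) =
      ∑ v ∈ I, (posStep (x v) - posStep (y v)) *
        ∏ u ∈ I.erase v, (posStep (x u - x v / y v * y u) - b u) := by
  have hne : ∀ v ∈ I, ∀ u ∈ I, v ≠ u → -x v / y v ≠ -x u / y u := fun v hv u hu hvu h =>
    hxy v hv u hu hvu (by rw [div_eq_div_iff (hy v hv) (hy u hu)] at h; linarith)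
  have hinj : Set.InjOn (fun v => -x v / y v) I := fun v hv u hu h =>
    by_contra fun hvu => hne v hv u hu hvu h
  rw [prod_sub_prod_eq_sum_of_injOn hinj]
  refine Finset.sum_congr rfl fun v hv => ?_
  rw [sub_sub_sub_cancel_right]
  by_cases hstep : posStep (x v) = posStep (y v)
  · rw [hstep, sub_self, zero_mul, zero_mul]
  · congr 1
    refine Finset.prod_congr rfl fun u hu => ?_
    obtain ⟨huv, hu⟩ := Finset.mem_erase.1 hu
    rw [posStep_sub_div_mul (hx v hv) (hy v hv) (hy u hu) hstep (hne v hv u hu huv.symm)]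
    split_ifs <;> rfl

end PosStep

section Series

theorem hasSum_int_posStep_sub_mul_exp {x : ℝ} (hx : x ≠ 0) :
    HasSum (fun k : ℤ => (posStep x - posStep (-k)) * Real.exp (-(k * x)))
      (1 / (1 - Real.exp (-x))) := by
  have hpos (j : ℕ) : posStep (-((j : ℤ) : ℝ)) = 0 := posStep_of_nonpos (by simp)
  have hneg (j : ℕ) : posStep (-((-(j + 1) : ℤ) : ℝ)) = 1 :=
    posStep_of_pos (by push_cast; linarith [(Nat.cast_nonneg j : (0 : ℝ) ≤ j)])
  rcases hx.lt_or_gt with h | h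
  · have hgeom := (hasSum_geometric_of_lt_one (Real.exp_pos x).le
      (Real.exp_lt_one_iff.2 h)).mul_left (-Real.exp x)
    have hsum : 0 + -Real.exp x * (1 - Real.exp x)⁻¹ = 1 / (1 - Real.exp (-x)) := by
      have hone_sub : 1 - Real.exp x ≠ 0 := (sub_pos.2 (Real.exp_lt_one_iff.2 h)).ne'
      have hsub_one : Real.exp x - 1 ≠ 0 := (sub_neg.2 (Real.exp_lt_one_iff.2 h)).ne
      rw [Real.exp_neg]
      field_simp
      ring
    rw [← hsum]
    refine HasSum.of_nat_of_neg_add_one (hasSum_zero.congr_fun fun j => ?_)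
      (hgeom.congr_fun fun j => ?_)
    · rw [posStep_of_nonpos h.le, hpos, sub_self, zero_mul]
    · rw [posStep_of_nonpos h.le, hneg, zero_sub, neg_mul, one_mul, neg_mul, ← Real.exp_nat_mul,
        ← Real.exp_add]
      push_cast
      ring_nf
  · have hgeom := hasSum_geometric_of_lt_one (Real.exp_pos (-x)).le
      (Real.exp_lt_one_iff.2 (neg_neg_of_pos h))
    rw [one_div, ← add_zero (1 - Real.exp (-x))⁻¹]
    refine HasSum.of_nat_of_neg_add_one (hgeom.congr_fun fun j => ?_)
      (hasSum_zero.congr_fun fun j => ?_)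
    · rw [posStep_of_pos h, hpos, ← Real.exp_nat_mul]
      push_cast
      ring_nf
    · rw [posStep_of_pos h, hneg, sub_self, zero_mul]

theorem hasSum_mul {𝕜 α β : Type*} [RCLike 𝕜] {f : α → 𝕜} {g : β → 𝕜} {a b : 𝕜}
    (hf : HasSum f a) (hg : HasSum g b) : HasSum (fun x : α × β => f x.1 * g x.2) (a * b) :=
  hf.mul hg (summable_mul_of_summable_norm hf.summable.norm hg.summable.norm)

theorem hasSum_fin_prod {β 𝕜 : Type*} [RCLike 𝕜] {n : ℕ} {f : Fin n → β → 𝕜} {a : Fin n → 𝕜}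
    (hf : ∀ i, HasSum (f i) (a i)) : HasSum (fun z : Fin n → β => ∏ i, f i (z i)) (∏ i, a i) := by
  induction n with
  | zero => simp
  | succ n ih =>
    rw [Fin.prod_univ_succ, ← (Fin.consEquiv fun _ => β).hasSum_iff]
    refine (hasSum_mul (hf 0) (ih fun i => hf i.succ)).congr_fun fun z => ?_
    simp [Fin.consEquiv, Fin.prod_univ_succ]

theorem hasSum_pi_prod {ι β 𝕜 : Type*} [Fintype ι] [RCLike 𝕜] {f : ι → β → 𝕜} {a : ι → 𝕜}
    (hf : ∀ i, HasSum (f i) (a i)) :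
    HasSum (fun z : ι → β => ∏ i, f i (z i)) (∏ i, a i) := by
  let e := (Fintype.equivFin ι).symm
  rw [← e.prod_comp, ← (e.arrowCongr (Equiv.refl β)).hasSum_iff]
  refine (hasSum_fin_prod fun k => hf (e k)).congr_fun fun z => ?_
  simp [← e.prod_comp]

variable {V : Type*} [AddCommGroup V] [Module ℝ V] {N : Submodule ℤ V} {I : Finset V} {x : V}

theorem IsLatticeBasis.hasSum_prod_posStep_mul_exp (hI : IsLatticeBasis N I)
    (hspan : Submodule.span ℝ (I : Set V) = ⊤) (hx : ∀ v ∈ I, coord ℝ I v x ≠ 0) :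
    HasSum (fun μ : dualLattice N =>
        (∏ v ∈ I, (posStep (coord ℝ I v x) - posStep (-μ.1 v))) * Real.exp (-μ.1 x))
      (∏ v ∈ I, 1 / (1 - Real.exp (-coord ℝ I v x))) := by
  have hpi := hasSum_pi_prod fun v : I => hasSum_int_posStep_sub_mul_exp (hx v v.2)
  rw [Finset.prod_coe_sort I fun v => 1 / (1 - Real.exp (-coord ℝ I v x)),
    ← (hI.dualLatticeEquiv hspan).hasSum_iff] at hpi
  refine hpi.congr_fun fun μ => ?_
  simp only [Function.comp_apply, hI.dualLatticeEquiv_apply]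
  rw [Finset.prod_coe_sort I fun v =>
      (posStep (coord ℝ I v x) - posStep (-μ.1 v)) * Real.exp (-(μ.1 v * coord ℝ I v x)),
    Finset.prod_mul_distrib, ← Real.exp_sum, Finset.sum_neg_distrib,
    apply_eq_sum_coord_mul hI.linearIndepOn (hspan ▸ Submodule.mem_top) μ.1]
  simp only [mul_comm]

end Series

section Todd

/-- The Todd function `x / (1 - exp (-x))`. The division gives `todd 0 = 0` instead of the limit
`1`, so its expansion at `0` is only stated on the punctured neighborhood. -/
noncomputable def todd (x : ℝ) : ℝ := x / (1 - Real.exp (-x))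

open Polynomial in
/-- The expansion of `todd (c * X)` up to order three; the coefficient of `X ^ 3` vanishes. -/
noncomputable def toddPolynomial (c : ℝ) : ℝ[X] := 1 + C (c / 2) * X + C (c ^ 2 / 12) * X ^ 2

theorem eval_toddPolynomial (c t : ℝ) :
    (toddPolynomial c).eval t = 1 + t * c / 2 + (t * c) ^ 2 / 12 := by
  simp only [toddPolynomial, Polynomial.eval_add, Polynomial.eval_mul, Polynomial.eval_one,
    Polynomial.eval_C, Polynomial.eval_X, Polynomial.eval_pow]
  ring

theorem coeff_toddPolynomial (c : ℝ) (k : ℕ) : (toddPolynomial c).coeff k =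
    if k = 0 then 1 else if k = 1 then c / 2 else if k = 2 then c ^ 2 / 12 else 0 := by
  rcases k with _ | _ | _ | k <;> simp [toddPolynomial, Polynomial.coeff_one, Polynomial.coeff_X]

theorem todd_sub_isLittleO :
    (fun x => todd x - (1 + x / 2 + x ^ 2 / 12)) =o[𝓝[≠] 0] fun x => x ^ 3 := by
  set E : ℝ → ℝ := fun x => Real.exp (-x) - ∑ i ∈ Finset.range 5, (-x) ^ i / i.factorial with hE
  have hE4 : E =o[𝓝 0] fun x => x ^ 4 := by
    have hneg : Tendsto (fun x : ℝ => -x) (𝓝 0) (𝓝 0) := by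
      simpa using continuous_neg.tendsto (0 : ℝ)
    simpa [Function.comp_def, Even.neg_pow (by decide : Even 4)] using
      (Real.exp_sub_sum_range_succ_isLittleO_pow 4).comp_tendsto hneg
  have hpoly : (fun x : ℝ => x ^ 5 * (1 / 144 + x / 288)) =o[𝓝 0] fun x => x ^ 4 := by
    simpa only [mul_one] using (isLittleO_pow_pow (by norm_num : 4 < 5)).mul_isBigO <|
      (Continuous.tendsto (by fun_prop : Continuous fun x : ℝ => 1 / 144 + x / 288) 0).isBigO_one ℝ
  have hnum : (fun x => x - (1 + x / 2 + x ^ 2 / 12) * (1 - Real.exp (-x))) =o[𝓝 0]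
      fun x => x ^ 4 := by
    have hbdd : (fun x : ℝ => 1 + x / 2 + x ^ 2 / 12) =O[𝓝 0] fun _ => (1 : ℝ) :=
      (Continuous.tendsto (by fun_prop) 0).isBigO_one ℝ
    have hPE := hbdd.mul_isLittleO hE4
    simp only [one_mul] at hPE
    refine (hpoly.add hPE).congr_left fun x => ?_
    simp only [hE, Finset.sum_range_succ, Finset.sum_range_zero, Nat.factorial]
    push_cast
    ring
  have hden : (fun x : ℝ => x) =O[𝓝 0] fun x => 1 - Real.exp (-x) := by
    have hderiv : HasDerivAt (fun x => 1 - Real.exp (-x)) 1 0 := by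
      simpa using ((hasDerivAt_neg (0 : ℝ)).exp.const_sub 1)
    simpa [Function.comp_def] using
      (hderiv.isTheta_sub one_ne_zero).isBigO_symm.comp_tendsto tendsto_id
  have hquot := (hnum.mul_isBigO (hden.inv_rev <| eventually_of_mem univ_mem fun x _ hx => by
    simp [hx])).mono (nhdsWithin_le_nhds (s := {0}ᶜ))
  refine hquot.congr' ?_ ?_ <;> filter_upwards [self_mem_nhdsWithin] with x hx
  · have hx' : 1 - Real.exp (-x) ≠ 0 :=
      sub_ne_zero.2 fun h => hx (by simpa using h.symm)
    rw [todd]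
    field_simp
  · have hx' : x ≠ 0 := hx
    field_simp

theorem todd_mul_sub_isLittleO {c : ℝ} (hc : c ≠ 0) :
    (fun t => todd (t * c) - (toddPolynomial c).eval t) =o[𝓝[≠] 0] fun t => t ^ 3 := by
  have hlim : Tendsto (fun t : ℝ => t * c) (𝓝[≠] 0) (𝓝[≠] 0) := by
    refine tendsto_nhdsWithin_iff.2 ⟨?_, ?_⟩
    · simpa using ((continuous_mul_const c).tendsto 0).mono_left nhdsWithin_le_nhds
    · filter_upwards [self_mem_nhdsWithin] with t ht using mul_ne_zero ht hc
  simp only [eval_toddPolynomial]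
  refine (todd_sub_isLittleO.comp_tendsto hlim).trans_isBigO ?_
  simp only [Function.comp_def, mul_pow, mul_comm _ (c ^ 3)]
  exact (isBigO_refl _ _).const_mul_left _

theorem isLittleO_prod_sub_prod {ι α 𝕜 : Type*} [NormedField 𝕜]
    {l : Filter α} {I : Finset ι} {f g : ι → α → 𝕜} {h : α → 𝕜}
    (hf : ∀ i ∈ I, f i =O[l] fun _ => (1 : 𝕜)) (hg : ∀ i ∈ I, g i =O[l] fun _ => (1 : 𝕜))
    (hfg : ∀ i ∈ I, (fun t => f i t - g i t) =o[l] h) :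
    (fun t => ∏ i ∈ I, f i t - ∏ i ∈ I, g i t) =o[l] h := by
  classical
  induction I using Finset.induction_on with
  | empty => simp
  | insert a I ha ih =>
    simp only [Finset.forall_mem_insert] at hf hg hfg
    have hprod : (fun t => ∏ i ∈ I, f i t) =O[l] fun _ => (1 : 𝕜) := by
      simpa using IsBigO.finsetProd hf.2
    have hfirst := hfg.1.mul_isBigO hprod
    have hsecond := hg.1.mul_isLittleO (ih hf.2 hg.2 hfg.2)
    simp only [mul_one, one_mul] at hfirst hsecond
    refine (hfirst.add hsecond).congr_left fun t => ?_
    rw [Finset.prod_insert ha, Finset.prod_insert ha]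
    ring

theorem prod_todd_sub_isLittleO {ι : Type*} {I : Finset ι} {c : ι → ℝ} (hc : ∀ v ∈ I, c v ≠ 0) :
    (fun t => ∏ v ∈ I, todd (t * c v) - (∏ v ∈ I, toddPolynomial (c v)).eval t)
      =o[𝓝[≠] 0] fun t => t ^ 3 := by
  have hpow : (fun t : ℝ => t ^ 3) =O[𝓝[≠] 0] fun _ => (1 : ℝ) :=
    (((continuous_pow 3).tendsto 0).mono_left nhdsWithin_le_nhds).isBigO_one ℝ
  have hpoly (v : ι) : (fun t => (toddPolynomial (c v)).eval t) =O[𝓝[≠] 0] fun _ => (1 : ℝ) :=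
    (((toddPolynomial (c v)).continuous.tendsto 0).mono_left nhdsWithin_le_nhds).isBigO_one ℝ
  simp only [Polynomial.eval_prod]
  refine isLittleO_prod_sub_prod (fun v hv => ?_) (fun v _ => hpoly v)
    fun v hv => todd_mul_sub_isLittleO (hc v hv)
  have hdiff := ((todd_mul_sub_isLittleO (hc v hv)).trans_isBigO hpow).isBigO
  exact (hdiff.add (hpoly v)).congr_left fun t => sub_add_cancel _ _

theorem coeff_eq_zero_of_eval_isLittleO {𝕜 : Type*} [NontriviallyNormedField 𝕜]
    {p : Polynomial 𝕜} {n k : ℕ} (hp : (fun t => p.eval t) =o[𝓝[≠] 0] fun t => t ^ n)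
    (hk : k ≤ n) : p.coeff k = 0 := by
  have hconst {p : Polynomial 𝕜} {n : ℕ}
      (hp : (fun t => p.eval t) =o[𝓝[≠] 0] fun t => t ^ n) : p.coeff 0 = 0 := by
    have hlim : Tendsto (fun t : 𝕜 => t ^ n) (𝓝[≠] 0) (𝓝 (0 ^ n)) :=
      ((continuous_pow n).tendsto 0).mono_left nhdsWithin_le_nhds
    rw [Polynomial.coeff_zero_eq_eval_zero]
    exact tendsto_nhds_unique ((p.continuous.tendsto 0).mono_left nhdsWithin_le_nhds)
      ((isLittleO_one_iff 𝕜).1 (hp.trans_isBigO (hlim.isBigO_one 𝕜)))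
  induction k generalizing p n with
  | zero => exact hconst hp
  | succ k ih =>
    obtain ⟨n, rfl⟩ := Nat.exists_eq_add_of_le' (Nat.one_le_of_lt hk)
    rw [← Polynomial.coeff_divX]
    refine ih (((isBigO_refl (fun t : 𝕜 => t⁻¹) _).mul_isLittleO hp).congr' ?_ ?_)
      (Nat.le_of_succ_le_succ hk) <;> filter_upwards [self_mem_nhdsWithin] with t ht
    · conv_lhs => rw [← Polynomial.divX_mul_X_add p, hconst hp]
      simp [mul_comm _ t, inv_mul_cancel_left₀ (show t ≠ 0 from ht)]
    · rw [pow_succ', inv_mul_cancel_left₀ ht]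

theorem coeff_prod_toddPolynomial {ι : Type*} {I : Finset ι} (hI : I.card = 3) {c : ι → ℝ}
    (hc : ∀ v ∈ I, c v ≠ 0) : (∏ v ∈ I, toddPolynomial (c v)).coeff 3 =
      (∏ v ∈ I, c v) * ((∑ v ∈ I, c v) * ∑ v ∈ I, (c v)⁻¹) / 24 := by
  classical
  obtain ⟨u, v, w, huv, huw, hvw, rfl⟩ := Finset.card_eq_three.1 hI
  have hu : c u ≠ 0 := hc u (by simp)
  have hv : c v ≠ 0 := hc v (by simp)
  have hw : c w ≠ 0 := hc w (by simp)
  have hnot : u ∉ ({v, w} : Finset ι) := by simp [huv, huw]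
  rw [Finset.prod_insert hnot, Finset.prod_pair hvw, Finset.prod_insert hnot, Finset.prod_pair hvw,
    Finset.sum_insert hnot, Finset.sum_pair hvw, Finset.sum_insert hnot, Finset.sum_pair hvw]
  simp only [Polynomial.coeff_mul, coeff_toddPolynomial, mul_ite, mul_one, ite_mul, one_mul,
    zero_mul, mul_zero, Finset.Nat.sum_antidiagonal_eq_sum_range_succ_mk, Nat.succ_eq_add_one,
    Finset.sum_range_succ, tsub_self, ↓reduceIte, Nat.reduceAdd, Finset.range_one,
    Finset.sum_singleton, tsub_zero, OfNat.ofNat_ne_zero, OfNat.ofNat_ne_one, Nat.succ_ne_self,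
    Nat.add_one_sub_one, one_ne_zero, zero_add, Nat.reduceSub, add_zero]
  field_simp
  ring

end Todd

namespace ConeFan

variable {V : Type*} [NormedAddCommGroup V] [NormedSpace ℝ V] {N : Submodule ℤ V}
  [DiscreteTopology N] {Δ : ConeFan V} {I I' J : Finset V} {k l : ℕ} {v x : V}

section Simplices

theorem mem_rayGenerators :
    v ∈ Δ.rayGenerators N ↔ IsPrimitiveVector N v ∧ hull ℝ {v} ∈ Δ.cones := by
  simp [rayGenerators]

theorem mem_simplices : I ∈ Δ.simplices N k ↔
    I ⊆ Δ.rayGenerators N ∧ I.card = k ∧ hull ℝ (I : Set V) ∈ Δ.cones := by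
  simp [simplices, and_assoc]

theorem mem_of_mem_hull (hI : I ∈ Δ.simplices N k) (hv : v ∈ Δ.rayGenerators N)
    (hvI : v ∈ hull ℝ (I : Set V)) : v ∈ I := by
  obtain ⟨hvprim, hvcone⟩ := mem_rayGenerators.1 hv
  obtain ⟨hIray, -, hIcone⟩ := mem_simplices.1 hI
  have hface : (hull ℝ {v}).IsFaceOf (hull ℝ (I : Set V)) := by
    have hinf := (Δ.inf_isFaceOf _ hvcone _ hIcone).2
    rwa [inf_eq_left.2 (Submodule.span_le.2 (Set.singleton_subset_iff.2 hvI))] at hinf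
  obtain ⟨c, hc, hsum⟩ := mem_hull_finset.1 hvI
  obtain ⟨w, hw, hcw⟩ : ∃ w ∈ I, 0 < c w := by
    by_contra! hle
    refine hvprim.2.1 (hsum ▸ Finset.sum_eq_zero fun w hw => ?_)
    rw [le_antisymm (hle w hw) (hc w), zero_smul]
  have hwv : w ∈ hull ℝ {v} := mem_of_isFaceOf_hull_of_sum_smul_mem hface (fun u _ => hc u)
    (by rw [hsum]; exact subset_hull rfl) hw hcw
  have hwprim := (mem_rayGenerators.1 (hIray hw)).1
  obtain ⟨⟨r, hr⟩, hrv : r • v = w⟩ := Submodule.mem_span_singleton.1 hwv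
  have hr0 : r ≠ 0 := by
    rintro rfl
    exact hwprim.2.1 (by rw [← hrv, zero_smul])
  rwa [hvprim.eq_of_hull_eq hwprim (by rw [← hrv, hull_singleton_smul (hr.lt_of_ne' hr0)])]

theorem subset_of_sum_smul_mem_hull (hI : I ∈ Δ.simplices N k) (hI' : I' ∈ Δ.simplices N l)
    {c : V → ℝ} (hc : ∀ v ∈ I, 0 < c v) (h : ∑ v ∈ I, c v • v ∈ hull ℝ (I' : Set V)) : I ⊆ I' := by
  obtain ⟨hIray, -, hIcone⟩ := mem_simplices.1 hI
  have hface := (Δ.inf_isFaceOf _ hIcone _ (mem_simplices.1 hI').2.2).1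
  have hc' : ∀ v ∈ I, 0 ≤ c v := fun v hv => (hc v hv).le
  exact fun v hv => mem_of_mem_hull hI' (hIray hv) <|
    (mem_of_isFaceOf_hull_of_sum_smul_mem hface hc' ⟨sum_smul_mem_hull hc', h⟩ hv (hc v hv)).2

theorem exists_mem_cones_add_smul_mem (hc : Δ.IsComplete)
    (hclosed : ∀ σ ∈ Δ.cones, IsClosed (σ : Set V)) (p x : V) :
    ∃ σ ∈ Δ.cones, p ∈ σ ∧ ∃ t : ℝ, 0 < t ∧ p + t • x ∈ σ := by
  obtain ⟨σ, hσ, hfreq⟩ : ∃ σ ∈ Δ.cones, ∃ᶠ t : ℝ in 𝓝[>] 0, p + t • x ∈ σ := by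
    by_contra! h
    obtain ⟨t, ht⟩ := ((Filter.eventually_all_finset _).2 h).exists
    obtain ⟨σ, hσ, hσt⟩ := hc (p + t • x)
    exact ht σ hσ hσt
  have hlim : Tendsto (fun t : ℝ => p + t • x) (𝓝[>] 0) (𝓝 p) := by
    have hcont : Continuous fun t : ℝ => p + t • x := by fun_prop
    simpa using (hcont.tendsto 0).mono_left nhdsWithin_le_nhds
  obtain ⟨t, ht, htpos⟩ := (hfreq.and_eventually self_mem_nhdsWithin).exists
  exact ⟨σ, hσ, (hclosed σ hσ).mem_of_frequently_of_tendsto hfreq hlim, t, htpos, ht⟩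

variable [IsZLattice ℝ N] [FiniteDimensional ℝ V]

theorem exists_simplex_of_mem_cones (hu : Δ.IsUnimodular N) {σ : PointedCone ℝ V}
    (hσ : σ ∈ Δ.cones) : ∃ I : Finset V, I ∈ Δ.simplices N I.card ∧ σ = hull ℝ (I : Set V) ∧
      ∃ B, IsLatticeBasis N B ∧ I ⊆ B := by
  obtain ⟨B, hB, I, hIB, rfl⟩ := exists_isLatticeBasis_of_isUnimodularCone (hu σ hσ)
  refine ⟨I, mem_simplices.2 ⟨fun v hv => ?_, rfl, hσ⟩, rfl, B, hB, hIB⟩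
  have hface := isFaceOf_hull_of_subset (hB.linearIndepOn.mono (Finset.coe_subset.2 hIB))
    (Finset.singleton_subset_iff.2 hv)
  rw [Finset.coe_singleton] at hface
  exact mem_rayGenerators.2 ⟨hB.isPrimitiveVector (hIB hv), Δ.face_mem _ hσ _ hface⟩

theorem exists_isLatticeBasis_of_mem_simplices (hu : Δ.IsUnimodular N)
    (hI : I ∈ Δ.simplices N k) : ∃ B, IsLatticeBasis N B ∧ I ⊆ B := by
  obtain ⟨hIray, -, hIcone⟩ := mem_simplices.1 hI
  obtain ⟨I', hI', hhull, B, hB, hIB⟩ := exists_simplex_of_mem_cones hu hIcone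
  exact ⟨B, hB, fun v hv => hIB (mem_of_mem_hull hI' (hIray hv) (hhull ▸ subset_hull hv))⟩

theorem linearIndepOn_of_mem_simplices (hu : Δ.IsUnimodular N) (hI : I ∈ Δ.simplices N k) :
    LinearIndepOn ℝ id (I : Set V) := by
  obtain ⟨B, hB, hIB⟩ := exists_isLatticeBasis_of_mem_simplices hu hI
  exact hB.linearIndepOn.mono (Finset.coe_subset.2 hIB)

theorem mem_simplices_of_subset (hu : Δ.IsUnimodular N) (hI : I ∈ Δ.simplices N k) (hJ : J ⊆ I) :
    J ∈ Δ.simplices N J.card := by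
  have hind := linearIndepOn_of_mem_simplices hu hI
  rw [mem_simplices] at hI ⊢
  exact ⟨hJ.trans hI.1, rfl, Δ.face_mem _ hI.2.2 _ (isFaceOf_hull_of_subset hind hJ)⟩

theorem isClosed_of_mem_cones (hu : Δ.IsUnimodular N) {σ : PointedCone ℝ V} (hσ : σ ∈ Δ.cones) :
    IsClosed (σ : Set V) := by
  obtain ⟨I, hI, rfl, -⟩ := exists_simplex_of_mem_cones hu hσ
  exact isClosed_hull_of_linearIndepOn (linearIndepOn_of_mem_simplices hu hI)

theorem exists_insert_mem_simplices [DecidableEq V] (hc : Δ.IsComplete) (hu : Δ.IsUnimodular N)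
    (hJ : J ∈ Δ.simplices N k) {f : V →ₗ[ℝ] ℝ} (hf : ∀ v ∈ J, f v = 0) (hx : 0 < f x) :
    ∃ i, 0 < f i ∧ insert i J ∈ Δ.simplices N (k + 1) := by
  obtain ⟨σ, hσ, hp, t, ht, hpt⟩ := exists_mem_cones_add_smul_mem hc
    (fun σ hσ => isClosed_of_mem_cones hu hσ) (∑ v ∈ J, (1 : ℝ) • v) x
  obtain ⟨I, hI, rfl, -⟩ := exists_simplex_of_mem_cones hu hσ
  have hJI : J ⊆ I := subset_of_sum_smul_mem_hull hJ hI (fun _ _ => one_pos) hp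
  obtain ⟨c, hc0, hsum⟩ := mem_hull_finset.1 hpt
  have hpos : 0 < ∑ v ∈ I, c v * f v := by
    have hfsum := congrArg f hsum
    simp only [map_sum, map_smul, map_add, smul_eq_mul, one_mul] at hfsum
    rw [hfsum, Finset.sum_eq_zero hf, zero_add]
    exact mul_pos ht hx
  obtain ⟨i, hi, hfi⟩ := Finset.exists_lt_of_sum_lt (f := fun _ => (0 : ℝ)) (by simpa using hpos)
  have hfi : 0 < f i := pos_of_mul_pos_right hfi (hc0 i)
  refine ⟨i, hfi, ?_⟩
  have hins := mem_simplices_of_subset hu hI (Finset.insert_subset hi hJI)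
  rwa [Finset.card_insert_of_notMem fun h => hfi.ne' (hf i h), (mem_simplices.1 hJ).2.1] at hins

end Simplices

section Chambers

/-- The chambers of a fan in an `n`-dimensional space: the maximal simplices of `K`, which have `n`
vertices. -/
noncomputable abbrev chambers (Δ : ConeFan V) (N : Submodule ℤ V) [DiscreteTopology N] :
    Finset (Finset V) :=
  Δ.simplices N (Module.finrank ℝ V)

variable [IsZLattice ℝ N] [FiniteDimensional ℝ V]

theorem isLatticeBasis_of_mem_chambers (hu : Δ.IsUnimodular N) (hI : I ∈ Δ.chambers N) :
    IsLatticeBasis N I := by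
  obtain ⟨B, hB, hIB⟩ := exists_isLatticeBasis_of_mem_simplices hu hI
  rwa [Finset.eq_of_subset_of_card_le hIB (by rw [hB.card_eq_finrank, (mem_simplices.1 hI).2.1])]

theorem sum_coord_smul_of_mem_chambers (hu : Δ.IsUnimodular N) (hI : I ∈ Δ.chambers N) (x : V) :
    ∑ v ∈ I, coord ℝ I v x • v = x := by
  have hB := isLatticeBasis_of_mem_chambers hu hI
  exact sum_coord_smul hB.linearIndepOn (hB.span_real_eq_top ▸ Submodule.mem_top)

theorem subset_of_coord_pos (hu : Δ.IsUnimodular N) (hI : I ∈ Δ.chambers N)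
    (hI' : I' ∈ Δ.simplices N k) (hpos : ∀ v ∈ I, 0 < coord ℝ I v x)
    (hx : x ∈ hull ℝ (I' : Set V)) : I ⊆ I' :=
  subset_of_sum_smul_mem_hull hI hI' hpos <| by rwa [sum_coord_smul_of_mem_chambers hu hI]

theorem mem_hull_of_coord_pos (hu : Δ.IsUnimodular N) (hI : I ∈ Δ.chambers N)
    (hpos : ∀ v ∈ I, 0 < coord ℝ I v x) : x ∈ hull ℝ (I : Set V) := by
  rw [← sum_coord_smul_of_mem_chambers hu hI x]
  exact sum_smul_mem_hull fun v hv => (hpos v hv).le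

theorem eq_of_coord_insert_pos [DecidableEq V] {i i' : V} (hu : Δ.IsUnimodular N)
    (hi : insert i J ∈ Δ.chambers N) (hi' : insert i' J ∈ Δ.chambers N) (hiJ : i ∉ J)
    (hpos : 0 < coord ℝ (insert i J) i i') : i = i' := by
  have hind := linearIndepOn_of_mem_simplices hu hi
  have hsmall : ∀ᶠ ε : ℝ in 𝓝[>] 0, ∀ v ∈ J, 0 < 1 + ε * coord ℝ (insert i J) v i' := by
    refine (Filter.eventually_all_finset _).2 fun v _ => nhdsWithin_le_nhds ?_
    have hcont : Continuous fun ε : ℝ => 1 + ε * coord ℝ (insert i J) v i' := by fun_prop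
    exact hcont.continuousAt.eventually (lt_mem_nhds (by simp))
  obtain ⟨ε, hε, hε0 : 0 < ε⟩ := (hsmall.and self_mem_nhdsWithin).exists
  have hcoord : ∀ v ∈ insert i J, 0 < coord ℝ (insert i J) v (∑ w ∈ J, (1 : ℝ) • w + ε • i') := by
    intro v hv
    rw [map_add, map_smul, smul_eq_mul]
    rcases Finset.mem_insert.1 hv with rfl | hvJ
    · rw [map_sum, Finset.sum_eq_zero fun w hw => by
        rw [map_smul, coord_insert_self_of_mem hind hiJ hw, smul_zero], zero_add]
      exact mul_pos hε0 hpos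
    · rw [coord_sum_smul_of_subset hind (Finset.subset_insert i J) (fun _ => 1) hvJ]
      exact hε v hvJ
  have hmem : ∑ w ∈ J, (1 : ℝ) • w + ε • i' ∈ hull ℝ (↑(insert i' J) : Set V) :=
    add_mem (Submodule.span_mono (Finset.coe_subset.2 (Finset.subset_insert i' J))
        (sum_smul_mem_hull fun _ _ => zero_le_one))
      ((hull ℝ _).smul_mem hε0.le (subset_hull (Finset.mem_insert_self i' J)))
  exact (Finset.mem_insert.1 (subset_of_coord_pos hu hi hi' hcoord hmem
    (Finset.mem_insert_self i J))).resolve_right hiJ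

end Chambers

section Walls

open Classical in
/-- `i` and `i'` complete the wall `J` to its two chambers, which lie on different sides of the
hyperplane spanned by `J`. -/
structure IsOpposite (Δ : ConeFan V) (N : Submodule ℤ V) [DiscreteTopology N] (J : Finset V)
    (i i' : V) : Prop where
  left_mem : insert i J ∈ Δ.chambers N
  right_mem : insert i' J ∈ Δ.chambers N
  left_notMem : i ∉ J
  coord_neg : coord ℝ (insert i J) i i' < 0

variable {i i' j : V} {c : ℤ} [IsZLattice ℝ N] [FiniteDimensional ℝ V]

namespace IsOpposite

theorem ne (hu : Δ.IsUnimodular N) (h : IsOpposite Δ N J i i') : i ≠ i' := by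
  classical
  rintro rfl
  have hneg := h.coord_neg
  rw [coord_self (linearIndepOn_of_mem_simplices hu h.left_mem) (Finset.mem_insert_self i J)]
    at hneg
  exact hneg.not_ge zero_le_one

open Classical in
theorem right_notMem (hu : Δ.IsUnimodular N) (h : IsOpposite Δ N J i i') : i' ∉ J := fun hi' =>
  h.coord_neg.ne <|
    coord_insert_self_of_mem (linearIndepOn_of_mem_simplices hu h.left_mem) h.left_notMem hi'

open Classical in
theorem coord_eq_neg_one (hu : Δ.IsUnimodular N) (h : IsOpposite Δ N J i i') :
    coord ℝ (insert i J) i i' = -1 :=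
  ((isLatticeBasis_of_mem_chambers hu h.left_mem).coord_eq_one_or_neg_one
    (isLatticeBasis_of_mem_chambers hu h.right_mem) h.left_notMem).resolve_left
      fun hone => h.coord_neg.not_ge (hone ▸ zero_le_one)

open Classical in
theorem coord_right (hu : Δ.IsUnimodular N) (h : IsOpposite Δ N J i i') :
    coord ℝ (insert i' J) i' = -coord ℝ (insert i J) i := by
  have hI' := isLatticeBasis_of_mem_chambers hu h.right_mem
  rw [coord_insert_self_exchange (linearIndepOn_of_mem_simplices hu h.left_mem)
    hI'.linearIndepOn hI'.span_real_eq_top h.left_notMem h.coord_neg.ne, h.coord_eq_neg_one hu,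
    inv_neg_one, neg_one_smul]

open Classical in
theorem coord_wall (hu : Δ.IsUnimodular N) (h : IsOpposite Δ N J i i') (hj : j ∈ J) :
    coord ℝ (insert i' J) j =
      coord ℝ (insert i J) j + coord ℝ (insert i J) j i' • coord ℝ (insert i J) i := by
  have hI' := isLatticeBasis_of_mem_chambers hu h.right_mem
  rw [coord_insert_of_mem_exchange (linearIndepOn_of_mem_simplices hu h.left_mem)
    hI'.linearIndepOn hI'.span_real_eq_top h.left_notMem h.coord_neg.ne hj, h.coord_eq_neg_one hu,
    div_neg, div_one, neg_smul, sub_neg_eq_add]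

open Classical in
theorem eq_or_eq (hu : Δ.IsUnimodular N) (h : IsOpposite Δ N J i i') {k : V}
    (hk : insert k J ∈ Δ.chambers N) : k = i ∨ k = i' := by
  rcases (isLatticeBasis_of_mem_chambers hu h.left_mem).coord_eq_one_or_neg_one
    (isLatticeBasis_of_mem_chambers hu hk) h.left_notMem with hone | hneg
  · exact .inl (eq_of_coord_insert_pos hu h.left_mem hk h.left_notMem (hone ▸ one_pos)).symm
  · refine .inr (eq_of_coord_insert_pos hu h.right_mem hk (h.right_notMem hu) ?_).symm
    rw [h.coord_right hu, LinearMap.neg_apply, hneg, neg_neg]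
    exact one_pos

theorem exists_hasCurvature (hu : Δ.IsUnimodular N) (h : IsOpposite Δ N J i i') :
    ∃ c, Δ.HasCurvature N J c := by
  classical
  have hi' := (isLatticeBasis_of_mem_chambers hu h.right_mem).mem_lattice
    (Finset.mem_insert_self i' J)
  obtain ⟨a, hsum, ha⟩ :=
    (isLatticeBasis_of_mem_chambers hu h.left_mem).exists_sum_int_smul_eq hi'
  have hai : a i = -1 := by
    exact_mod_cast (ha i (Finset.mem_insert_self i J)).trans (h.coord_eq_neg_one hu)
  rw [Finset.sum_insert h.left_notMem, hai, neg_one_smul, neg_add_eq_sub] at hsum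
  exact ⟨_, i, i', a, h.ne hu, h.left_mem, h.right_mem, hsum.symm, rfl⟩

open Classical in
theorem cast_eq_of_hasCurvature (hu : Δ.IsUnimodular N) (h : IsOpposite Δ N J i i')
    (hc : Δ.HasCurvature N J c) : (c : ℝ) = 2 - ∑ j ∈ J, coord ℝ (insert i J) j i' := by
  obtain ⟨k, k', a, hne, hk, hk', hrel, rfl⟩ := hc
  have hind := linearIndepOn_of_mem_simplices hu h.left_mem
  have hpair : k' + k = i' + i := by
    rcases h.eq_or_eq hu hk with rfl | rfl <;> rcases h.eq_or_eq hu hk' with rfl | rfl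
    exacts [absurd rfl hne, rfl, add_comm _ _, absurd rfl hne]
  have hsum : ∑ j ∈ J, (a j : ℝ) • j = i' + i := by
    simp only [Int.cast_smul_eq_zsmul]
    rw [← hpair, hrel, sub_add_cancel]
  push_cast
  congr 1
  refine Finset.sum_congr rfl fun j hj => ?_
  rw [← coord_sum_smul_of_subset hind (Finset.subset_insert i J) (fun j => (a j : ℝ)) hj, hsum,
    map_add, coord_of_ne hind (Finset.mem_insert_self i J)
      (ne_of_mem_of_not_mem hj h.left_notMem).symm, add_zero]

open Classical in
theorem cast_curv_eq (hu : Δ.IsUnimodular N) (h : IsOpposite Δ N J i i') :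
    (Δ.curv N J : ℝ) = 2 - ∑ j ∈ J, coord ℝ (insert i J) j i' :=
  h.cast_eq_of_hasCurvature hu (Classical.epsilon_spec (h.exists_hasCurvature hu))

end IsOpposite

variable [Nontrivial V]

theorem exists_isOpposite (hc : Δ.IsComplete) (hu : Δ.IsUnimodular N) (hJ : J ∈ Δ.walls N) :
    ∃ i i', IsOpposite Δ N J i i' := by
  classical
  have hpos := Module.finrank_pos (R := ℝ) (M := V)
  obtain ⟨B, hB, hJB⟩ := exists_isLatticeBasis_of_mem_simplices hu hJ
  obtain ⟨b, hbJ, rfl⟩ := Finset.exists_eq_insert_iff.2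
    ⟨hJB, show J.card + 1 = B.card by rw [hB.card_eq_finrank, (mem_simplices.1 hJ).2.1]; omega⟩
  set f := coord ℝ (insert b J) b
  have hfJ : ∀ w ∈ J, f w = 0 := fun w hw => coord_insert_self_of_mem hB.linearIndepOn hbJ hw
  have hfb : f b = 1 := coord_self hB.linearIndepOn (Finset.mem_insert_self b J)
  obtain ⟨i, hfi, hi⟩ := exists_insert_mem_simplices hc hu hJ hfJ (hfb ▸ one_pos)
  obtain ⟨i', hfi', hi'⟩ := exists_insert_mem_simplices (f := -f) (x := -b) hc hu hJ
    (fun w hw => by rw [LinearMap.neg_apply, hfJ w hw, neg_zero]) (by simp [hfb])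
  rw [Nat.sub_add_cancel hpos] at hi hi'
  have hI := isLatticeBasis_of_mem_chambers hu hi
  have hcoord := apply_eq_coord_insert_mul hI.linearIndepOn (x := i')
    (hI.span_real_eq_top ▸ Submodule.mem_top) hfJ
  refine ⟨i, i', hi, hi', fun h => hfi.ne' (hfJ i h), ?_⟩
  exact neg_of_mul_neg_left (hcoord ▸ neg_pos.1 hfi') hfi.le

theorem existsUnique_hasCurvature (hc : Δ.IsComplete) (hu : Δ.IsUnimodular N)
    (hJ : J ∈ Δ.walls N) : ∃! c, Δ.HasCurvature N J c := by
  obtain ⟨i, i', h⟩ := exists_isOpposite hc hu hJ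
  obtain ⟨c, hcurv⟩ := h.exists_hasCurvature hu
  refine ⟨c, hcurv, fun d hd => Int.cast_injective (α := ℝ) ?_⟩
  rw [h.cast_eq_of_hasCurvature hu hd, h.cast_eq_of_hasCurvature hu hcurv]

open Classical in
theorem sum_sum_eq_sum_walls {M : Type*} [AddCommMonoid M] (hc : Δ.IsComplete)
    (hu : Δ.IsUnimodular N) {g : Finset V → V → M} {h : Finset V → M}
    (hgh : ∀ J ∈ Δ.walls N, ∀ i i', IsOpposite Δ N J i i' →
      g (insert i J) i + g (insert i' J) i' = h J) :
    ∑ I ∈ Δ.chambers N, ∑ v ∈ I, g I v = ∑ J ∈ Δ.walls N, h J := by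
  rw [Finset.sum_sigma' (Δ.chambers N) (fun I => I) (fun I v => g I v)]
  have hmaps : ∀ p ∈ (Δ.chambers N).sigma (fun I => I), p.1.erase p.2 ∈ Δ.walls N := by
    rintro ⟨I, v⟩ hp
    obtain ⟨hI, hv⟩ := Finset.mem_sigma.1 hp
    have herase := mem_simplices_of_subset hu hI (Finset.erase_subset v I)
    rwa [Finset.card_erase_of_mem hv, (mem_simplices.1 hI).2.1] at herase
  rw [← Finset.sum_fiberwise_of_maps_to hmaps]
  refine Finset.sum_congr rfl fun J hJ => ?_
  obtain ⟨i, i', hii'⟩ := exists_isOpposite hc hu hJ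
  have hfiber : {p ∈ (Δ.chambers N).sigma (fun I => I) | p.1.erase p.2 = J} =
      {⟨insert i J, i⟩, ⟨insert i' J, i'⟩} := by
    ext ⟨I, v⟩
    simp only [Finset.mem_filter, Finset.mem_sigma, Finset.mem_insert, Finset.mem_singleton]
    constructor
    · rintro ⟨⟨hI, hv⟩, rfl⟩
      rw [← Finset.insert_erase hv] at hI
      rcases hii'.eq_or_eq hu hI with rfl | rfl
      · exact .inl (by rw [Finset.insert_erase hv])
      · exact .inr (by rw [Finset.insert_erase hv])
    · rintro (h | h) <;> cases h
      · exact ⟨⟨hii'.left_mem, Finset.mem_insert_self i J⟩, Finset.erase_insert hii'.left_notMem⟩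
      · exact ⟨⟨hii'.right_mem, Finset.mem_insert_self i' J⟩,
          Finset.erase_insert (hii'.right_notMem hu)⟩
  rw [hfiber, Finset.sum_pair fun h => hii'.ne hu (congrArg Sigma.snd h), hgh J hJ i i' hii']

end Walls

section Generic

/-- A vector is generic if it lies in no proper subspace spanned by rays of the fan. -/
def IsGeneric (Δ : ConeFan V) (N : Submodule ℤ V) [DiscreteTopology N] (x : V) : Prop :=
  ∀ I ⊆ Δ.rayGenerators N, Submodule.span ℝ (I : Set V) ≠ ⊤ → x ∉ Submodule.span ℝ (I : Set V)

theorem exists_isGeneric (Δ : ConeFan V) (N : Submodule ℤ V) [DiscreteTopology N]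
    {s : Finset (V →ₗ[ℝ] ℝ)} (hs : 0 ∉ s) : ∃ x, Δ.IsGeneric N x ∧ ∀ f ∈ s, f x ≠ 0 := by
  classical
  let spans := (Δ.rayGenerators N).powerset.image fun I : Finset V => Submodule.span ℝ (I : Set V)
  let t : Finset (Submodule ℝ V) := s.image LinearMap.ker ∪ {p ∈ spans | p ≠ ⊤}
  have ht : ⊤ ∉ t := by
    simp only [t, Finset.mem_union, Finset.mem_image, Finset.mem_filter, not_or]
    refine ⟨?_, fun h => h.2 rfl⟩
    rintro ⟨f, hf, hker⟩
    exact hs (LinearMap.ker_eq_top.1 hker ▸ hf)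
  obtain ⟨x, hx⟩ := (Set.ne_univ_iff_exists_notMem _).1
    (Subspace.biUnion_ne_univ_of_top_notMem (s := t) ht)
  simp only [Set.mem_iUnion, not_exists] at hx
  refine ⟨x, fun I hI hne => hx _ ?_, fun f hf => hx (LinearMap.ker f) ?_⟩
  · exact Finset.mem_union_right _ (Finset.mem_filter.2
      ⟨Finset.mem_image_of_mem _ (Finset.mem_powerset.2 hI), hne⟩)
  · exact Finset.mem_union_left _ (Finset.mem_image_of_mem _ hf)

theorem IsGeneric.smul {t : ℝ} (ht : t ≠ 0) (hx : Δ.IsGeneric N x) : Δ.IsGeneric N (t • x) :=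
  fun I hI hne h => hx I hI hne ((Submodule.smul_mem_iff _ ht).1 h)

variable [IsZLattice ℝ N] [FiniteDimensional ℝ V]

theorem IsGeneric.coord_ne_zero (hu : Δ.IsUnimodular N) (hx : Δ.IsGeneric N x)
    (hI : I ∈ Δ.chambers N) (hv : v ∈ I) : coord ℝ I v x ≠ 0 := by
  classical
  intro hzero
  have hind := linearIndepOn_of_mem_simplices hu hI
  refine hx (I.erase v) ((Finset.erase_subset _ _).trans (mem_simplices.1 hI).1) ?_ ?_
  · intro htop
    have hcoord : coord ℝ I v = 0 := LinearMap.ext_on htop fun w hw =>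
      coord_of_ne hind (Finset.mem_of_mem_erase hw) (Finset.ne_of_mem_erase hw)
    exact one_ne_zero (α := ℝ) (by rw [← coord_self hind hv, hcoord, LinearMap.zero_apply])
  · rw [← sum_coord_smul_of_mem_chambers hu hI x, ← Finset.add_sum_erase I _ hv, hzero, zero_smul,
      zero_add]
    exact Submodule.sum_mem _ fun w hw => Submodule.smul_mem _ _ (Submodule.subset_span hw)

theorem IsGeneric.exists_chamber_coord_pos (hc : Δ.IsComplete) (hu : Δ.IsUnimodular N)
    (hx : Δ.IsGeneric N x) : ∃ I ∈ Δ.chambers N, ∀ v ∈ I, 0 < coord ℝ I v x := by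
  obtain ⟨σ, hσ, hxσ⟩ := hc x
  obtain ⟨I, hI, rfl, -⟩ := exists_simplex_of_mem_cones hu hσ
  have hind := linearIndepOn_of_mem_simplices hu hI
  have htop : Submodule.span ℝ (I : Set V) = ⊤ := by
    by_contra hne
    exact hx I (mem_simplices.1 hI).1 hne (hull_le_span ℝ (I : Set V) hxσ)
  rw [← finrank_span_finset_eq_card hind, htop, finrank_top] at hI
  exact ⟨I, hI, fun v hv => (((mem_hull_iff_coord_nonneg hind).1 hxσ).2 v hv).lt_of_ne'
    (hx.coord_ne_zero hu hI hv)⟩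

theorem IsGeneric.sum_curv_eq [Nontrivial V] (hc : Δ.IsComplete) (hu : Δ.IsUnimodular N)
    (hx : Δ.IsGeneric N x) : ∑ J ∈ Δ.walls N, (Δ.curv N J : ℝ) =
      ∑ I ∈ Δ.chambers N, (∑ v ∈ I, coord ℝ I v x) * ∑ v ∈ I, (coord ℝ I v x)⁻¹ := by
  classical
  simp only [Finset.mul_sum]
  refine (sum_sum_eq_sum_walls hc hu fun J _ i i' h => ?_).symm
  have hne : coord ℝ (insert i J) i x ≠ 0 :=
    hx.coord_ne_zero hu h.left_mem (Finset.mem_insert_self i J)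
  have hsum : ∑ j ∈ J, coord ℝ (insert i' J) j x = ∑ j ∈ J, coord ℝ (insert i J) j x +
      (∑ j ∈ J, coord ℝ (insert i J) j i') * coord ℝ (insert i J) i x := by
    rw [Finset.sum_mul, ← Finset.sum_add_distrib]
    exact Finset.sum_congr rfl fun j hj => by
      rw [h.coord_wall hu hj, LinearMap.add_apply, LinearMap.smul_apply, smul_eq_mul]
  rw [h.cast_curv_eq hu, Finset.sum_insert h.left_notMem, Finset.sum_insert (h.right_notMem hu),
    hsum, h.coord_right hu, LinearMap.neg_apply]
  field_simp
  ring

end Generic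

section SignedCount

/-- The line through `x` and `y` meets the coordinate hyperplanes of each chamber in distinct
points, so that it crosses the walls one at a time. -/
def InGeneralPosition (Δ : ConeFan V) (N : Submodule ℤ V) [DiscreteTopology N] (x y : V) : Prop :=
  ∀ I ∈ Δ.chambers N, ∀ v ∈ I, ∀ w ∈ I, v ≠ w →
    coord ℝ I v x * coord ℝ I w y ≠ coord ℝ I w x * coord ℝ I v y

/-- The sum over the chambers `I` of `∏ (posStep (coord ℝ I v x) - b v)`. If `b` takes the values
`0` and `1`, this counts, with sign, the chambers for which every `v` satisfies
`0 < coord ℝ I v x ↔ b v = 0`. -/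
noncomputable def signedCount (Δ : ConeFan V) (N : Submodule ℤ V) [DiscreteTopology N]
    (b : V → ℝ) (x : V) : ℝ :=
  ∑ I ∈ Δ.chambers N, ∏ v ∈ I, (posStep (coord ℝ I v x) - b v)

variable {y : V} {μ : V →ₗ[ℝ] ℝ} [IsZLattice ℝ N] [FiniteDimensional ℝ V]

theorem IsGeneric.exists_inGeneralPosition (hu : Δ.IsUnimodular N) (hx : Δ.IsGeneric N x)
    (hμ : μ ≠ 0) : ∃ y, Δ.IsGeneric N y ∧ Δ.InGeneralPosition N x y ∧ μ y < 0 := by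
  classical
  let wedge (I : Finset V) (p : V × V) : V →ₗ[ℝ] ℝ :=
    coord ℝ I p.1 x • coord ℝ I p.2 - coord ℝ I p.2 x • coord ℝ I p.1
  let s := insert μ ((Δ.chambers N).biUnion fun I => I.offDiag.image (wedge I))
  have hs : 0 ∉ s := by
    simp only [s, Finset.mem_insert, Finset.mem_biUnion, Finset.mem_image, Finset.mem_offDiag,
      not_or]
    refine ⟨hμ.symm, ?_⟩
    rintro ⟨I, hI, ⟨v, w⟩, ⟨hv, hw, hvw⟩, hzero⟩
    have hind := linearIndepOn_of_mem_simplices hu hI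
    have hzero_w := LinearMap.congr_fun hzero w
    simp [wedge, coord_self hind hw, coord_of_ne hind hw hvw.symm, hx.coord_ne_zero hu hI hv]
      at hzero_w
  obtain ⟨y, hy, hys⟩ := Δ.exists_isGeneric N hs
  have hgen : Δ.InGeneralPosition N x y := fun I hI v hv w hw hvw => by
    have hwedge := hys (wedge I (v, w)) (Finset.mem_insert_of_mem (Finset.mem_biUnion.2
      ⟨I, hI, Finset.mem_image_of_mem _ (Finset.mem_offDiag.2 ⟨hv, hw, hvw⟩)⟩))
    simpa [wedge, sub_eq_zero] using hwedge
  rcases (hys μ (Finset.mem_insert_self _ _)).lt_or_gt with hneg | hpos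
  · exact ⟨y, hy, hgen, hneg⟩
  · refine ⟨(-1 : ℝ) • y, hy.smul (neg_ne_zero.2 one_ne_zero), ?_, by simpa using hpos⟩
    simpa [InGeneralPosition] using hgen

theorem InGeneralPosition.signedCount_eq [Nontrivial V] (hc : Δ.IsComplete)
    (hu : Δ.IsUnimodular N) (hx : Δ.IsGeneric N x) (hy : Δ.IsGeneric N y)
    (hxy : Δ.InGeneralPosition N x y) (b : V → ℝ) :
    Δ.signedCount N b x = Δ.signedCount N b y := by
  classical
  rw [← sub_eq_zero, signedCount, signedCount, ← Finset.sum_sub_distrib,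
    Finset.sum_congr rfl fun I hI => prod_posStep_sub_prod_posStep
      (fun v hv => hx.coord_ne_zero hu hI hv) (fun v hv => hy.coord_ne_zero hu hI hv)
      (hxy I hI) b,
    ← Finset.sum_const_zero (s := Δ.walls N)]
  refine sum_sum_eq_sum_walls hc hu fun J _ i i' h => ?_
  have hi := Finset.mem_insert_self i J
  have hprod : ∏ u ∈ J, (posStep (coord ℝ (insert i' J) u x - coord ℝ (insert i' J) i' x /
        coord ℝ (insert i' J) i' y * coord ℝ (insert i' J) u y) - b u) =
      ∏ u ∈ J, (posStep (coord ℝ (insert i J) u x - coord ℝ (insert i J) i x /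
        coord ℝ (insert i J) i y * coord ℝ (insert i J) u y) - b u) := by
    refine Finset.prod_congr rfl fun u hu' => ?_
    have hyi := hy.coord_ne_zero hu h.left_mem hi
    rw [h.coord_wall hu hu', h.coord_right hu]
    congr 2
    simp only [LinearMap.add_apply, LinearMap.smul_apply, LinearMap.neg_apply, smul_eq_mul,
      neg_div_neg_eq]
    field_simp
    ring
  rw [Finset.erase_insert h.left_notMem, Finset.erase_insert (h.right_notMem hu), hprod,
    h.coord_right hu, LinearMap.neg_apply, LinearMap.neg_apply,
    posStep_neg (hx.coord_ne_zero hu h.left_mem hi),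
    posStep_neg (hy.coord_ne_zero hu h.left_mem hi)]
  ring

theorem IsGeneric.signedCount_zero (hc : Δ.IsComplete) (hu : Δ.IsUnimodular N)
    (hx : Δ.IsGeneric N x) : Δ.signedCount N 0 x = 1 := by
  obtain ⟨I, hI, hpos⟩ := hx.exists_chamber_coord_pos hc hu
  simp only [signedCount, Pi.zero_apply, sub_zero]
  rw [Finset.sum_eq_single_of_mem I hI]
  · exact Finset.prod_eq_one fun v hv => posStep_of_pos (hpos v hv)
  · intro I' hI' hne
    by_contra hprod
    have hpos' : ∀ v ∈ I', 0 < coord ℝ I' v x := fun v hv => by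
      by_contra hle
      exact hprod (Finset.prod_eq_zero hv (posStep_of_nonpos (not_lt.1 hle)))
    refine hne (Finset.eq_of_subset_of_card_le
      (subset_of_coord_pos hu hI' hI hpos' (mem_hull_of_coord_pos hu hI hpos)) ?_)
    rw [(mem_simplices.1 hI).2.1, (mem_simplices.1 hI').2.1]

theorem signedCount_posStep_of_apply_neg (hu : Δ.IsUnimodular N) (hμ : μ y < 0) :
    Δ.signedCount N (fun v => posStep (-μ v)) y = 0 := by
  refine Finset.sum_eq_zero fun I hI => ?_
  have hI' := isLatticeBasis_of_mem_chambers hu hI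
  rw [apply_eq_sum_coord_mul hI'.linearIndepOn (hI'.span_real_eq_top ▸ Submodule.mem_top)] at hμ
  obtain ⟨v, hv, hneg⟩ := Finset.exists_lt_of_sum_lt (g := fun _ => (0 : ℝ)) (by simpa using hμ)
  refine Finset.prod_eq_zero hv (sub_eq_zero.2 (?_ : _ = posStep (-μ v)))
  rcases mul_neg_iff.1 hneg with ⟨hpos, hμv⟩ | ⟨hneg, hμv⟩
  · rw [posStep_of_pos hpos, posStep_of_pos (neg_pos.2 hμv)]
  · rw [posStep_of_nonpos hneg.le, posStep_of_nonpos (neg_nonpos.2 hμv.le)]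

theorem IsGeneric.signedCount_posStep_eq_zero (hc : Δ.IsComplete) (hu : Δ.IsUnimodular N)
    (hx : Δ.IsGeneric N x) (hμ : μ ≠ 0) : Δ.signedCount N (fun v => posStep (-μ v)) x = 0 := by
  obtain ⟨y, hy, hxy, hμy⟩ := hx.exists_inGeneralPosition hu hμ
  have : Nontrivial V := nontrivial_of_ne y 0 (by rintro rfl; simp at hμy)
  rw [hxy.signedCount_eq hc hu hx hy, signedCount_posStep_of_apply_neg hu hμy]

end SignedCount

section DualLatticeSum

variable [IsZLattice ℝ N] [FiniteDimensional ℝ V]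

theorem IsGeneric.sum_prod_one_div_one_sub_exp (hc : Δ.IsComplete) (hu : Δ.IsUnimodular N)
    (hx : Δ.IsGeneric N x) :
    ∑ I ∈ Δ.chambers N, ∏ v ∈ I, 1 / (1 - Real.exp (-coord ℝ I v x)) = 1 := by
  have hsum := hasSum_sum fun I (hI : I ∈ Δ.chambers N) =>
    have hB := isLatticeBasis_of_mem_chambers hu hI
    hB.hasSum_prod_posStep_mul_exp hB.span_real_eq_top fun v hv => hx.coord_ne_zero hu hI hv
  simp only [← Finset.sum_mul] at hsum
  let zero : dualLattice N := ⟨0, fun _ _ => ⟨0, by simp⟩⟩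
  have hzero : Δ.signedCount N (fun v => posStep (-zero.1 v)) x * Real.exp (-zero.1 x) = 1 := by
    have hb : (fun v => posStep (-zero.1 v)) = 0 :=
      funext fun v => posStep_of_nonpos (by simp [zero])
    rw [hb, hx.signedCount_zero hc hu]
    simp [zero]
  refine (hsum.unique (hasSum_single zero fun μ hμ => ?_)).trans hzero
  exact mul_eq_zero_of_left
    (hx.signedCount_posStep_eq_zero hc hu fun h => hμ (Subtype.ext h)) _

theorem IsGeneric.sum_prod_todd (hc : Δ.IsComplete) (hu : Δ.IsUnimodular N)
    (hx : Δ.IsGeneric N x) {t : ℝ} (ht : t ≠ 0) :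
    ∑ I ∈ Δ.chambers N, (∏ v ∈ I, coord ℝ I v x)⁻¹ * ∏ v ∈ I, todd (t * coord ℝ I v x) =
      t ^ Module.finrank ℝ V := by
  rw [← mul_one (t ^ _), ← (hx.smul ht).sum_prod_one_div_one_sub_exp hc hu, Finset.mul_sum]
  refine Finset.sum_congr rfl fun I hI => ?_
  rw [← (mem_simplices.1 hI).2.1, ← Finset.prod_const, ← Finset.prod_inv_distrib,
    ← Finset.prod_mul_distrib, ← Finset.prod_mul_distrib]
  refine Finset.prod_congr rfl fun v hv => ?_
  have hne := hx.coord_ne_zero hu hI hv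
  rw [todd, map_smul, smul_eq_mul]
  field_simp

theorem IsGeneric.sum_sum_coord_mul_sum_inv_coord (hV : Module.finrank ℝ V = 3)
    (hc : Δ.IsComplete) (hu : Δ.IsUnimodular N) (hx : Δ.IsGeneric N x) :
    ∑ I ∈ Δ.chambers N, (∑ v ∈ I, coord ℝ I v x) * ∑ v ∈ I, (coord ℝ I v x)⁻¹ = 24 := by
  have hne {I : Finset V} (hI : I ∈ Δ.chambers N) : ∀ v ∈ I, coord ℝ I v x ≠ 0 :=
    fun v hv => hx.coord_ne_zero hu hI hv
  let q : Polynomial ℝ := Polynomial.X ^ 3 - ∑ I ∈ Δ.chambers N,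
    Polynomial.C (∏ v ∈ I, coord ℝ I v x)⁻¹ * ∏ v ∈ I, toddPolynomial (coord ℝ I v x)
  have hq : (fun t => q.eval t) =o[𝓝[≠] 0] fun t => t ^ 3 := by
    refine (IsLittleO.sum fun I hI => (prod_todd_sub_isLittleO (hne hI)).const_mul_left
      (∏ v ∈ I, coord ℝ I v x)⁻¹).congr' ?_ .rfl
    filter_upwards [self_mem_nhdsWithin] with t ht
    simp only [Finset.sum_apply, mul_sub, Finset.sum_sub_distrib]
    rw [hx.sum_prod_todd hc hu ht, hV]
    simp [q, Polynomial.eval_finsetSum]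
  have hcoeff := coeff_eq_zero_of_eval_isLittleO hq le_rfl
  have hterm : ∀ I ∈ Δ.chambers N, (Polynomial.C (∏ v ∈ I, coord ℝ I v x)⁻¹ *
      ∏ v ∈ I, toddPolynomial (coord ℝ I v x)).coeff 3 =
        ((∑ v ∈ I, coord ℝ I v x) * ∑ v ∈ I, (coord ℝ I v x)⁻¹) / 24 := fun I hI => by
    rw [Polynomial.coeff_C_mul, coeff_prod_toddPolynomial (hV ▸ (mem_simplices.1 hI).2.1) (hne hI),
      mul_div_assoc, inv_mul_cancel_left₀ (Finset.prod_ne_zero_iff.2 (hne hI))]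
  rw [Polynomial.coeff_sub, Polynomial.coeff_X_pow_self, Polynomial.finsetSum_coeff,
    Finset.sum_congr rfl hterm, ← Finset.sum_div] at hcoeff
  linarith

end DualLatticeSum

end ConeFan

theorem mainTheorem3 {V : Type*} [NormedAddCommGroup V] [NormedSpace ℝ V]
    (hV : Module.finrank ℝ V = 3)
    (N : Submodule ℤ V) [DiscreteTopology N] [IsZLattice ℝ N]
    (Δ : ConeFan V) (hcomplete : Δ.IsComplete) (hunimodular : Δ.IsUnimodular N) :
    (∀ J ∈ Δ.walls N, ∃! c : ℤ, Δ.HasCurvature N J c) ∧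
      ∑ J ∈ Δ.walls N, Δ.curv N J = 24 := by
  have hpos : 0 < Module.finrank ℝ V := hV ▸ three_pos
  have : FiniteDimensional ℝ V := Module.finite_of_finrank_pos hpos
  have : Nontrivial V := Module.nontrivial_of_finrank_pos hpos
  refine ⟨fun J hJ => ConeFan.existsUnique_hasCurvature hcomplete hunimodular hJ, ?_⟩
  obtain ⟨x, hx, -⟩ := Δ.exists_isGeneric N (Finset.notMem_empty 0)
  have hsum := (hx.sum_curv_eq hcomplete hunimodular).trans
    (hx.sum_sum_coord_mul_sum_inv_coord hV hcomplete hunimodular)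
  exact_mod_cast hsum
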